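/- **Conventions.** For a group $G$, a *$G$-complex* is a finite connected aspherical simplicial complex $X$ with $\pi_1(X)\cong G$, and $\mathrm{gd}(G)$ is the minimal dimension of a $G$-complex. A finitely generated group $H$ has *subexponential growth* if $\lim_{t\to\infty}\frac1t\log\#\{h\in H: \|h\|_S\le t\}=0$ for every finite generating set $S$, where $\|\cdot\|_S$ is the word length. Its *subexponential growth rate* is then $\nu(H)=\limsup_{t\to\infty}\frac{\log\log\#\{h\in H:\|h\|_S\le t\}}{\log t}$, which does not depend on $S$ (with $\nu(H)=0$ for the trivial group). A simplicial complex $X$ of dimension $m$ satisfies the *fiber $\pi_1$-growth collapsing assumption* (FCA) if there is a simplicial map $f\colon X\to P$ to a finite simplicial complex $P$ of some dimension $k$ such that for every point $p\in P$ and every connected component $F_0$ of $f^{-1}(p)$, the image of $\pi_1(F_0)\to\pi_1(X)$ induced by inclusion is finitely generated, of subexponential growth, and of subexponential growth rate less than $\frac{m-k}{m}$. A *graph of groups* $\mathcal G$ consists of a finite connected graph $Y$ (loops and multiple edges allowed), whose oriented edges $e$ have an origin $o(e)$ and an opposite edge $\bar e\neq e$, of groups $G_v$ for the vertices $v$ and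 $G_e=G_{\bar e}$ for the edges, and of injective homomorphisms $h_e\colon G_e\to G_{o(e)}$. For a maximal tree $T\subseteq Y$, its fundamental group is generated by the groups $G_v$ and letters $x_e$, one for each oriented edge, subject to the relations of the groups $G_v$, to $x_e h_e(a)=h_{\bar e}(a)x_e$ for all $e$ and all $a\in G_e$, to $x_ex_{\bar e}=1$ for all $e$, and to $x_e=1$ for $e$ in $T$; up to isomorphism it does not depend on $T$. **Proposition.** Let $G$ be a group with $\mathrm{gd}(G)=2$. If $X$ is a $G$-complex with $\dim X=2$ and $X$ satisfies the FCA, then $G$ is isomorphic to the fundamental group of a graph of groups all of whose vertex groups and edge groups are finitely generated and have subexponential growth. -/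

import Mathlib

open Filter Topology

universe u v

noncomputable section

namespace FCAGraph

/-! ### Growth of groups -/

/-- The elements of `H` of word length at most `n` with respect to `S`: products of at most `n`
factors from `S ∪ S⁻¹`. -/
def wordBall {H : Type*} [Group H] (S : Finset H) (n : ℕ) : Set H :=
  {h | ∃ l : List H, l.length ≤ n ∧ (∀ a ∈ l, a ∈ S ∨ a⁻¹ ∈ S) ∧ l.prod = h}

/-- The number of elements of word length at most `n`. -/
def growthFunction {H : Type*} [Group H] (S : Finset H) (n : ℕ) : ℕ :=
  (wordBall S n).ncard

/-- `H` is finitely generated and its growth rate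
`δ(H, S) = lim (1/n) log #{h | ‖h‖_S ≤ n}` is `0` for every finite generating set `S`. -/
def HasSubexponentialGrowth (H : Type*) [Group H] : Prop :=
  Group.FG H ∧ ∀ S : Finset H, Subgroup.closure (S : Set H) = ⊤ →
    Tendsto (fun n : ℕ => Real.log (growthFunction S n) / n) atTop (𝓝 0)

/-- The subexponential growth rate
`ν(H) = limsup (log log #{h | ‖h‖_S ≤ n}) / log n` of a finitely generated group, where `S` is a
finite generating set. The upper limit is the same for all `S`, so the infimum over `S` only
selects this common value. If all balls have one element, then the convention `Real.log 0 = 0`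
yields `ν(H) = 0`, as it should be for the trivial group. -/
def subexponentialGrowthRate (H : Type*) [Group H] : EReal :=
  ⨅ (S : Finset H) (_ : Subgroup.closure (S : Set H) = ⊤),
    limsup (fun n : ℕ => ((Real.log (Real.log (growthFunction S n)) / Real.log n : ℝ) : EReal))
      atTop

/-! ### Finite simplicial complexes and simplicial maps

A finite simplicial complex is an `AbstractSimplicialComplex V` on a finite vertex type `V`. -/

section Complexes

variable {V : Type*} [Fintype V] {W : Type*} [Fintype W]

open Classical in
/-- The set of vertices with nonzero barycentric coordinate. -/
def coordSupport (x : stdSimplex ℝ V) : Finset V :=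
  Finset.univ.filter fun v => x v ≠ 0

/-- The geometric realization `|K|`, with the subspace topology of `stdSimplex ℝ V ⊆ ℝ^V`. -/
def realization (K : AbstractSimplicialComplex V) : Set (stdSimplex ℝ V) :=
  {x | coordSupport x ∈ K.faces}

/-- The dimension of a (nonempty, finite) complex. -/
def dimension (K : AbstractSimplicialComplex V) : ℕ :=
  sSup {d | ∃ s ∈ K.faces, s.card = d + 1}

open Classical in
/-- A vertex map that sends simplices to simplices. -/
def IsSimplicialMap (K : AbstractSimplicialComplex V) (L : AbstractSimplicialComplex W)
    (f : V → W) : Prop :=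
  ∀ s ∈ K.faces, s.image f ∈ L.faces

open Classical in
theorem coordSupport_map (f : V → W) (x : stdSimplex ℝ V) :
    coordSupport (stdSimplex.map f x) = (coordSupport x).image f := by
  ext w
  simp only [coordSupport, Finset.mem_filter, Finset.mem_univ, true_and, Finset.mem_image,
    stdSimplex.map_coe, FunOnFinite.linearMap_apply_apply]
  rw [ne_eq, Finset.sum_eq_zero_iff_of_nonneg (fun v _ => stdSimplex.zero_le x v)]
  simp [and_comm]

open Classical in
theorem map_mem_realization {K : AbstractSimplicialComplex V} {L : AbstractSimplicialComplex W}
    {f : V → W} (hf : IsSimplicialMap K L f) (x : realization K) :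
    stdSimplex.map f x.1 ∈ realization L := by
  have h := hf _ x.2
  rw [← coordSupport_map] at h
  exact h

/-- The piecewise affine map `|f| : |K| → |L|` of a simplicial map `f`. -/
def realizationMap {K : AbstractSimplicialComplex V} {L : AbstractSimplicialComplex W}
    {f : V → W} (hf : IsSimplicialMap K L f) : C(realization K, realization L) where
  toFun x := ⟨stdSimplex.map f x.1, map_mem_realization hf x⟩
  continuous_toFun :=
    ((stdSimplex.continuous_map f).comp continuous_subtype_val).subtype_mk _

end Complexes

/-! ### Groups of finite type -/

/-- `|K|` is connected and aspherical (its higher homotopy groups vanish) with fundamental group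
isomorphic to `G`; as `K` is finite, `K` is a `G`-complex. -/
structure IsGComplex (G : Type*) [Group G] {V : Type*} [Fintype V]
    (K : AbstractSimplicialComplex V) : Prop where
  pathConnected : PathConnectedSpace (realization K)
  fundamentalGroup : ∀ x : realization K, Nonempty (FundamentalGroup (realization K) x ≃* G)
  aspherical : ∀ n : ℕ, 2 ≤ n → ∀ x : realization K, Subsingleton (π_ n (realization K) x)

/-- The minimal dimension of a `G`-complex, and `⊤` if there is no `G`-complex. -/
def geometricDimension (G : Type*) [Group G] : ℕ∞ :=
  ⨅ (V : Type) (_ : Fintype V) (K : AbstractSimplicialComplex V) (_ : IsGComplex G K),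
    (dimension K : ℕ∞)

/-! ### The fiber `π₁`-growth collapsing assumption -/

/-- The image of `π₁(F₀, x)` in `π₁(X, x)`, where `F₀` is the connected component of `x` in the
subset `F` of `X`. -/
def inducedSubgroup {X : Type*} [TopologicalSpace X] (F : Set X) {x : X} (hx : x ∈ F) :
    Subgroup (FundamentalGroup X x) :=
  (FundamentalGroup.map
    (⟨Subtype.val, continuous_subtype_val⟩ : C(connectedComponentIn F x, X))
    ⟨x, mem_connectedComponentIn hx⟩).range

/-- For every component `F₀` of `F` (with an arbitrary base point `x`) the image of `π₁(F₀)` in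
`π₁(X)` has subexponential growth with subexponential growth rate less than `c`. -/
def HasSubexponentialGrowthWithRateLT {X : Type*} [TopologicalSpace X] (F : Set X) (c : ℝ) :
    Prop :=
  ∀ (x : X) (hx : x ∈ F), HasSubexponentialGrowth (inducedSubgroup F hx) ∧
    subexponentialGrowthRate (inducedSubgroup F hx) < (c : EReal)

/-- The fiber `π₁`-growth collapsing assumption: there is a simplicial map to a finite simplicial
complex `P` all of whose fibers have subexponential growth with subexponential growth rate less
than `(dim K - dim P) / dim K`. -/
def SatisfiesFCA {V : Type*} [Fintype V] (K : AbstractSimplicialComplex V) : Prop :=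
  ∃ (W : Type) (_ : Fintype W) (P : AbstractSimplicialComplex W) (f : V → W)
    (hf : IsSimplicialMap K P f), ∀ p : realization P,
      HasSubexponentialGrowthWithRateLT (realizationMap hf ⁻¹' {p})
        (((dimension K : ℝ) - dimension P) / dimension K)

/-! ### Graphs of groups -/

/-- A graph of groups on a finite connected graph. `Edge` is the set of geometric edges; the
oriented edges are the pairs `(e, b) : Edge × Bool`, with origin `origin e b` and opposite edge
`(e, !b)`, both with the edge group `eGroup e`. -/
structure GraphOfGroups where
  Vert : Type
  Edge : Type
  [finiteVert : Finite Vert]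
  [finiteEdge : Finite Edge]
  [nonemptyVert : Nonempty Vert]
  origin : Edge → Bool → Vert
  /-- the graph is connected -/
  connected : ∀ v w : Vert,
    Relation.ReflTransGen (fun a b => ∃ e c, origin e c = a ∧ origin e (!c) = b) v w
  vGroup : Vert → Type u
  eGroup : Edge → Type u
  [groupV : ∀ v, Group (vGroup v)]
  [groupE : ∀ e, Group (eGroup e)]
  /-- the inclusion of the edge group in the group of the origin, for each oriented edge -/
  incl : ∀ (e : Edge) (c : Bool), eGroup e →* vGroup (origin e c)
  incl_injective : ∀ e c, Function.Injective (incl e c)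

attribute [instance] GraphOfGroups.groupV GraphOfGroups.groupE

namespace GraphOfGroups

variable (𝒢 : GraphOfGroups.{u})

/-- `v` and `w` are joined by an edge path with edges in `T`. -/
def Joined (T : Set 𝒢.Edge) (v w : 𝒢.Vert) : Prop :=
  Relation.ReflTransGen
    (fun a b => ∃ e ∈ T, ∃ c, 𝒢.origin e c = a ∧ 𝒢.origin e (!c) = b) v w

/-- The subgraph with all vertices and with the edges in `T` is a tree: it is connected, and no
edge of `T` is a loop or lies on a cycle of edges in `T`. -/
def IsMaximalTree (T : Set 𝒢.Edge) : Prop :=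
  (∀ v w, 𝒢.Joined T v w) ∧
    ∀ e ∈ T, ¬ 𝒢.Joined (T \ {e}) (𝒢.origin e true) (𝒢.origin e false)

/-- The generators: the elements of the vertex groups, and a letter for each oriented edge. -/
abbrev Gen : Type u := (Σ v : 𝒢.Vert, 𝒢.vGroup v) ⊕ (𝒢.Edge × Bool)

/-- The element `a` of a vertex group, as a generator. -/
def vGen {v : 𝒢.Vert} (a : 𝒢.vGroup v) : FreeGroup 𝒢.Gen :=
  FreeGroup.of (Sum.inl ⟨v, a⟩)

/-- The letter `x_e` of an oriented edge. -/
def eGen (e : 𝒢.Edge) (c : Bool) : FreeGroup 𝒢.Gen :=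
  FreeGroup.of (Sum.inr (e, c))

/-- The relators of the fundamental group with respect to `T`. -/
inductive Relator (T : Set 𝒢.Edge) : FreeGroup 𝒢.Gen → Prop
  /-- the relations of the vertex groups -/
  | vertex (v : 𝒢.Vert) (a b : 𝒢.vGroup v) :
      Relator T (𝒢.vGen a * 𝒢.vGen b * (𝒢.vGen (a * b))⁻¹)
  /-- `x_e h_e(a) = h_ē(a) x_e` -/
  | edge (e : 𝒢.Edge) (c : Bool) (a : 𝒢.eGroup e) :
      Relator T ((𝒢.eGen e c * 𝒢.vGen (𝒢.incl e c a)) *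
        (𝒢.vGen (𝒢.incl e (!c) a) * 𝒢.eGen e c)⁻¹)
  /-- `x_e x_ē = 1` -/
  | inverse (e : 𝒢.Edge) (c : Bool) : Relator T (𝒢.eGen e c * 𝒢.eGen e (!c))
  /-- `x_e = 1` for the edges of the tree -/
  | tree (e : 𝒢.Edge) (c : Bool) (he : e ∈ T) : Relator T (𝒢.eGen e c)

/-- The fundamental group `π₁(𝒢)`, formed with a maximal tree `T`. -/
abbrev FundamentalGroup (T : Set 𝒢.Edge) : Type u :=
  PresentedGroup {r | 𝒢.Relator T r}

end GraphOfGroups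

end FCAGraph

end

/-! A growth rate is never negative, so the FCA with `dim X = 2` forces `(2 - dim P) / 2 > 0`: the
target `P` is a graph. Cover `|X|` by the path components of the preimages of the open stars of the
vertices of `P`. Distinct components meet only in path components of preimages of open edges, and
each of the latter lies in exactly two vertex pieces. Rescaling barycentric coordinates retracts
every piece to the fiber over a barycenter (`exists_homotopic_loop_in_fiber`), so its loops
represent exactly the image of `π₁` of a fiber component (`loopSubgroup_eq_inducedSubgroup`), which
has subexponential growth by assumption.

It remains to apply van Kampen's theorem to this graph of spaces. The vertex and edge groups are the
images in `G` of the groups of the pieces, so the edge maps are injective; passing to images does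
not change the result, because the kernels die in `G` anyway.

The van Kampen argument is phrased with path cocycles, that is, functors from the fundamental
groupoid to a group. A universal cocycle `L` with values in `G` is normalized along a maximal tree
(`exists_isNormalized`). On paths in one vertex space it lifts to the fundamental group of the graph
of groups. The edge relations make these lifts agree on overlaps (`localCocycle_eSpace`), so they
glue to a global cocycle `N` (`exists_isPathCocycle_of_local`). By universality `N` factors through
`L`, and the factor is inverse to the natural map to `G` (`bijective_toGroup`). -/

noncomputable section

namespace FCAGraph

/-! ### Path cocycles -/

section PathCocycles

open scoped unitInterval

variable {X : Type*} [TopologicalSpace X] {G : Type*} [Group G]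

/-- The affine path from `p` to `q` in the plane. -/
def affinePath (p q : ℝ × ℝ) : C(I, ℝ × ℝ) where
  toFun t := AffineMap.lineMap p q (t : ℝ)
  continuous_toFun := by
    simp only [AffineMap.lineMap_apply_module]
    fun_prop

theorem affinePath_apply (p q : ℝ × ℝ) (t : I) :
    affinePath p q t = AffineMap.lineMap p q (t : ℝ) := rfl

theorem affinePath_mem {S : Set (ℝ × ℝ)} (hS : Convex ℝ S) {p q : ℝ × ℝ} (hp : p ∈ S)
    (hq : q ∈ S) (t : I) : affinePath p q t ∈ S :=
  hS.lineMap_mem hp hq t.2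

/-- A function on paths that is multiplicative along the sides of all (possibly degenerate)
singular triangles. Such a function is the same thing as a functor from the fundamental groupoid
to a group. -/
def IsPathCocycle (L : C(I, X) → G) : Prop :=
  ∀ (H : C(ℝ × ℝ, X)) (p q r : ℝ × ℝ),
    L (H.comp (affinePath p q)) * L (H.comp (affinePath q r)) = L (H.comp (affinePath p r))

/-- A path cocycle that is only defined for paths in `C`. -/
def IsPathCocycleOn (C : Set X) (M : C(I, X) → G) : Prop :=
  ∀ (H : C(ℝ × ℝ, X)) (S : Set (ℝ × ℝ)), Convex ℝ S → (∀ x ∈ S, H x ∈ C) →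
    ∀ p ∈ S, ∀ q ∈ S, ∀ r ∈ S,
    M (H.comp (affinePath p q)) * M (H.comp (affinePath q r)) = M (H.comp (affinePath p r))

/-- The extension of a path to the plane that is constant in the second variable. -/
def planeExtend (γ : C(I, X)) : C(ℝ × ℝ, X) where
  toFun z := γ (Set.projIcc 0 1 zero_le_one z.1)
  continuous_toFun := γ.continuous.comp (continuous_projIcc.comp continuous_fst)

theorem planeExtend_apply (γ : C(I, X)) (z : ℝ × ℝ) :
    planeExtend γ z = γ (Set.projIcc 0 1 zero_le_one z.1) := rfl

theorem planeExtend_comp_affinePath (γ : C(I, X)) :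
    (planeExtend γ).comp (affinePath (0, 0) (1, 0)) = γ := by
  ext t
  simp [planeExtend_apply, affinePath_apply, AffineMap.lineMap_apply_module]

theorem lineMap_mem_Icc {s t : ℝ} (hs : s ∈ Set.Icc (0 : ℝ) 1) (ht : t ∈ Set.Icc (0 : ℝ) 1)
    {u : ℝ} (hu : u ∈ Set.Icc (0 : ℝ) 1) : AffineMap.lineMap s t u ∈ Set.Icc (0 : ℝ) 1 :=
  (convex_Icc (0 : ℝ) 1).lineMap_mem hs ht hu

theorem fst_lineMap' (p q : ℝ × ℝ) (t : ℝ) :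
    (AffineMap.lineMap p q t : ℝ × ℝ).1 = AffineMap.lineMap p.1 q.1 t := by
  simp [AffineMap.lineMap_apply_module]

theorem planeExtend_subpath (H : C(ℝ × ℝ, X)) (p q : ℝ × ℝ) {s t : ℝ}
    (hs : s ∈ Set.Icc (0 : ℝ) 1) (ht : t ∈ Set.Icc (0 : ℝ) 1) :
    (planeExtend (H.comp (affinePath p q))).comp (affinePath (s, 0) (t, 0)) =
      H.comp (affinePath (AffineMap.lineMap p q s) (AffineMap.lineMap p q t)) := by
  ext u
  have h := lineMap_mem_Icc hs ht u.2
  simp only [ContinuousMap.comp_apply, planeExtend_apply, affinePath_apply, fst_lineMap',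
    Set.projIcc_of_mem zero_le_one h]
  congr 1
  simp only [AffineMap.lineMap_apply_module, smul_eq_mul]
  ext <;> simp <;> ring

/-- Lebesgue number on a ball of the plane. -/
theorem exists_lebesgue {ι : Type*} {C : ι → Set X} (hC : ∀ i, IsOpen (C i))
    (hcov : ∀ x, ∃ i, x ∈ C i) (H : C(ℝ × ℝ, X)) (R : ℝ) :
    ∃ δ > 0, ∀ p ∈ Metric.closedBall (0 : ℝ × ℝ) R, ∃ i, ∀ z ∈ Metric.ball p δ, H z ∈ C i := by
  obtain ⟨δ, hδ, h⟩ := lebesgue_number_lemma_of_metric (c := fun i => H ⁻¹' (C i))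
    (isCompact_closedBall (0 : ℝ × ℝ) R) (fun i => (hC i).preimage H.continuous)
    (fun x _ => Set.mem_iUnion.2 (hcov (H x)))
  exact ⟨δ, hδ, h⟩

theorem dist_smul_div_le {p : ℝ × ℝ} {R : ℝ} (hp : ‖p‖ ≤ R) {N n : ℕ} (hN : 0 < N) :
    dist (((n : ℝ) / N) • p) ((((n + 1 : ℕ) : ℝ) / N) • p) ≤ R / N := by
  have hN' : (0 : ℝ) < N := by exact_mod_cast hN
  rw [dist_eq_norm, ← sub_smul, norm_smul]
  have : ((n : ℝ) / N - ((n + 1 : ℕ) : ℝ) / N) = -(1 / N) := by push_cast; ring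
  rw [this, norm_neg, norm_div, norm_one, Real.norm_natCast, one_div_mul_eq_div]
  gcongr

theorem norm_smul_div_le {p : ℝ × ℝ} {R : ℝ} (hp : ‖p‖ ≤ R) {N n : ℕ} (hn : n ≤ N) :
    ‖((n : ℝ) / N) • p‖ ≤ R := by
  rw [norm_smul]
  have h1 : ‖((n : ℝ) / N)‖ ≤ 1 := by
    rw [Real.norm_of_nonneg (by positivity)]
    exact div_le_one_of_le₀ (by exact_mod_cast hn) (by positivity)
  calc _ ≤ 1 * ‖p‖ := by gcongr
    _ ≤ R := by simpa using hp

/-- A locally defined cocycle on a ball is a coboundary. -/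
theorem exists_primitive_of_cocycle {c : ℝ × ℝ → ℝ × ℝ → G} {δ R : ℝ} (hδ : 0 < δ)
    (hc : ∀ p q r, ‖p‖ ≤ R → ‖q‖ ≤ R → ‖r‖ ≤ R → dist p q < δ → dist q r < δ → dist p r < δ →
      c p q * c q r = c p r) :
    ∃ g : ℝ × ℝ → G, ∀ p q, ‖p‖ ≤ R → ‖q‖ ≤ R → dist p q < δ / 2 → g q = g p * c p q := by
  rcases lt_or_ge R 0 with hR | hR
  · exact ⟨1, fun p q hp => absurd (hp.trans_lt hR) (norm_nonneg p).not_gt⟩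
  obtain ⟨N, hN⟩ := exists_nat_gt (R / (δ / 2))
  have hN0 : (0 : ℝ) < N := (by positivity : 0 ≤ R / (δ / 2)).trans_lt hN
  have hN1 : 0 < N := by exact_mod_cast hN0
  have hstep : R / N < δ / 2 := by
    rw [div_lt_iff₀ (by positivity)] at hN
    rw [div_lt_iff₀ hN0]
    linarith
  have hself : ∀ p, ‖p‖ ≤ R → c p p = 1 := fun p hp => by
    have := hc p p p hp hp hp (by simpa) (by simpa) (by simpa)
    simpa using this
  -- Radial integration: the product of `c` over the first `n` of `N` equal steps on the segment
  -- from the origin to `p`.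
  let g : ℕ → ℝ × ℝ → G := fun n p =>
    Nat.rec 1 (fun n x => x * c (((n : ℝ) / N) • p) ((((n + 1 : ℕ) : ℝ) / N) • p)) n
  -- Consecutive steps over `p` and `q` bound a quadrilateral with sides shorter than `δ / 2`; its
  -- diagonal is shorter than `δ` and cuts it into two triangles to which `hc` applies.
  have key : ∀ p q, ‖p‖ ≤ R → ‖q‖ ≤ R → dist p q < δ / 2 → ∀ n ≤ N,
      g n q = g n p * c (((n : ℝ) / N) • p) (((n : ℝ) / N) • q) := by
    intro p q hp hq hpq n
    have hd : ∀ n ≤ N, dist (((n : ℝ) / N) • p) (((n : ℝ) / N) • q) < δ / 2 := by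
      intro n hn
      rw [dist_smul₀, Real.norm_of_nonneg (by positivity)]
      have h1 : (n : ℝ) / N ≤ 1 := div_le_one_of_le₀ (by exact_mod_cast hn) (by positivity)
      nlinarith [dist_nonneg (x := p) (y := q)]
    induction n with
    | zero => intro _; simp [g, hself 0 (by simpa using hR)]
    | succ n ih =>
      intro hn
      have ih := ih (by omega)
      have e1 := hd n (by omega)
      have e2 := hd (n + 1) hn
      have e3 := (dist_smul_div_le hp (n := n) hN1).trans_lt hstep
      have e4 := (dist_smul_div_le hq (n := n) hN1).trans_lt hstep
      have m1 := norm_smul_div_le hp (show n ≤ N by omega)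
      have m2 := norm_smul_div_le hq (show n ≤ N by omega)
      have m3 := norm_smul_div_le hp hn
      have m4 := norm_smul_div_le hq hn
      have e5 : dist (((n : ℝ) / N) • p) ((((n + 1 : ℕ) : ℝ) / N) • q) < δ :=
        (dist_triangle _ _ _).trans_lt ((add_lt_add e1 e4).trans_eq (add_halves δ))
      change g n q * c (((n : ℝ) / N) • q) ((((n + 1 : ℕ) : ℝ) / N) • q) =
        g n p * c (((n : ℝ) / N) • p) ((((n + 1 : ℕ) : ℝ) / N) • p) * _
      rw [ih, mul_assoc, mul_assoc, hc _ _ _ m1 m2 m4 (by linarith) (by linarith) e5,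
        hc _ _ _ m1 m3 m4 (by linarith) (by linarith) e5]
  refine ⟨g N, fun p q hp hq hpq => ?_⟩
  have := key p q hp hq hpq N le_rfl
  simpa [div_self hN0.ne'] using this

/-! ### Gluing local path cocycles -/

variable {ι : Type*} {C : ι → Set X} {M : ι → C(I, X) → G}

/-- Local path cocycles which agree on overlaps have a primitive along every map of the plane. -/
theorem exists_local_primitive (hC : ∀ i, IsOpen (C i)) (hcov : ∀ x, ∃ i, x ∈ C i)
    (hM : ∀ i, IsPathCocycleOn (C i) (M i))
    (hagree : ∀ i j γ, (∀ t, γ t ∈ C i) → (∀ t, γ t ∈ C j) → M i γ = M j γ)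
    (H : C(ℝ × ℝ, X)) (R : ℝ) :
    ∃ (g : ℝ × ℝ → G), ∃ δ > 0, ∀ p q, ‖p‖ ≤ R → ‖q‖ ≤ R → dist p q < δ → ∀ i,
      (∀ t, H (affinePath p q t) ∈ C i) → g q = g p * M i (H.comp (affinePath p q)) := by
  classical
  obtain ⟨δ, hδ, h⟩ := exists_lebesgue hC hcov H R
  have : Nonempty ι := ⟨(hcov (H 0)).choose⟩
  choose! idx hidx using h
  have hself : ∀ p : ℝ × ℝ, p ∈ Metric.ball p δ := fun p => Metric.mem_ball_self hδ
  -- Each short segment is measured in the set attached to its starting point; agreement on overlaps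
  -- makes this a cocycle.
  obtain ⟨g, hg⟩ := exists_primitive_of_cocycle (c := fun p q => M (idx p) (H.comp (affinePath p q)))
    (δ := δ) (R := R) hδ (by
      intro p q r hp hq hr hpq hqr hpr
      have hp' : p ∈ Metric.closedBall (0 : ℝ × ℝ) R := by simpa using hp
      have hq' : q ∈ Metric.closedBall (0 : ℝ × ℝ) R := by simpa using hq
      have q1 : q ∈ Metric.ball p δ := by rwa [Metric.mem_ball, dist_comm]
      have r1 : r ∈ Metric.ball p δ := by rwa [Metric.mem_ball, dist_comm]
      have r2 : r ∈ Metric.ball q δ := by rwa [Metric.mem_ball, dist_comm]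
      rw [hagree (idx q) (idx p) _
        (fun t => hidx q hq' _ (affinePath_mem (convex_ball q δ) (hself q) r2 t))
        (fun t => hidx p hp' _ (affinePath_mem (convex_ball p δ) q1 r1 t))]
      exact hM (idx p) H _ (convex_ball p δ) (hidx p hp') p (hself p) q q1 r r1)
  refine ⟨g, δ / 2, by positivity, fun p q hp hq hpq i hi => ?_⟩
  rw [hg p q hp hq hpq]
  have hp' : p ∈ Metric.closedBall (0 : ℝ × ℝ) R := by simpa using hp
  have q1 : q ∈ Metric.ball p δ := by
    rw [Metric.mem_ball, dist_comm]; linarith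
  rw [hagree (idx p) i _
    (fun t => hidx p hp' _ (affinePath_mem (convex_ball p δ) (hself p) q1 t)) hi]

/-- A function on the interval whose local increments are given by `M`. -/
def IsPrimitiveAlong (C : ι → Set X) (M : ι → C(I, X) → G) (γ : C(I, X)) (g : ℝ → G) : Prop :=
  ∃ δ > 0, ∀ s ∈ Set.Icc (0 : ℝ) 1, ∀ t ∈ Set.Icc (0 : ℝ) 1, dist s t < δ → ∀ i,
    (∀ u, planeExtend γ (affinePath (s, 0) (t, 0) u) ∈ C i) →
      g t = g s * M i ((planeExtend γ).comp (affinePath (s, 0) (t, 0)))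

theorem nat_div_mem_Icc {N n : ℕ} (hn : n ≤ N) : (n : ℝ) / N ∈ Set.Icc (0 : ℝ) 1 :=
  ⟨by positivity, div_le_one_of_le₀ (by exact_mod_cast hn) (by positivity)⟩

/-- Induction along a path in small steps. -/
theorem interval_induction {Q : ℝ → Prop} (h0 : Q 0) {δ : ℝ} (hδ : 0 < δ)
    (hstep : ∀ s ∈ Set.Icc (0 : ℝ) 1, ∀ t ∈ Set.Icc (0 : ℝ) 1, dist s t < δ → Q s → Q t) :
    Q 1 := by
  obtain ⟨N, hN⟩ := exists_nat_gt (1 / δ)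
  have hN0 : (0 : ℝ) < N := (by positivity : 0 ≤ 1 / δ).trans_lt hN
  have key : ∀ n ≤ N, Q ((n : ℝ) / N) := by
    intro n
    induction n with
    | zero => intro _; simpa using h0
    | succ n ih =>
      intro hn
      refine hstep _ (nat_div_mem_Icc (by omega)) _ (nat_div_mem_Icc hn) ?_ (ih (by omega))
      rw [Real.dist_eq]
      have : ((n : ℝ) / N - ((n + 1 : ℕ) : ℝ) / N) = -(1 / N) := by push_cast; ring
      rw [this, abs_neg, abs_of_pos (by positivity)]
      rw [div_lt_iff₀ hδ] at hN
      rw [div_lt_iff₀ hN0]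
      linarith
  simpa [div_self hN0.ne'] using key N le_rfl

theorem planeExtend_mem_of_ball {γ : C(I, X)} {C : Set X} {δ s t : ℝ}
    (h : ∀ z ∈ Metric.ball ((s, 0) : ℝ × ℝ) δ, planeExtend γ z ∈ C) (hst : dist s t < δ) (u : I) :
    planeExtend γ (affinePath (s, 0) (t, 0) u) ∈ C := by
  refine h _ (affinePath_mem (convex_ball _ _) (Metric.mem_ball_self ?_) ?_ u)
  · exact dist_nonneg.trans_lt hst
  · rw [Metric.mem_ball, Prod.dist_eq, dist_comm]
    simpa using hst

theorem exists_lebesgue_path (hC : ∀ i, IsOpen (C i)) (hcov : ∀ x, ∃ i, x ∈ C i) (γ : C(I, X)) :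
    ∃ δ > 0, ∀ s ∈ Set.Icc (0 : ℝ) 1, ∃ i, ∀ t, dist s t < δ → ∀ u,
      planeExtend γ (affinePath (s, 0) (t, 0) u) ∈ C i := by
  obtain ⟨δ, hδ, h⟩ := exists_lebesgue hC hcov (planeExtend γ) 1
  refine ⟨δ, hδ, fun s hs => ?_⟩
  obtain ⟨i, hi⟩ := h (s, 0) (by simp [Prod.norm_def, abs_le]; exact ⟨by linarith [hs.1], hs.2⟩)
  exact ⟨i, fun t hst => planeExtend_mem_of_ball hi hst⟩

/-- On a sufficiently short step both functions are multiplied by the same value of some `M i`, so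
equality of the normalized values spreads from `0` to `1`. -/
theorem IsPrimitiveAlong.unique (hC : ∀ i, IsOpen (C i)) (hcov : ∀ x, ∃ i, x ∈ C i)
    {γ : C(I, X)} {g g' : ℝ → G} (hg : IsPrimitiveAlong C M γ g)
    (hg' : IsPrimitiveAlong C M γ g') : (g 0)⁻¹ * g 1 = (g' 0)⁻¹ * g' 1 := by
  obtain ⟨δ, hδ, h⟩ := hg
  obtain ⟨δ', hδ', h'⟩ := hg'
  obtain ⟨ε, hε, hL⟩ := exists_lebesgue_path hC hcov γ
  refine interval_induction (Q := fun t => (g 0)⁻¹ * g t = (g' 0)⁻¹ * g' t) (by simp)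
    (lt_min hδ (lt_min hδ' hε)) fun s hs t ht hst hQ => ?_
  simp only [lt_min_iff] at hst
  obtain ⟨i, hi⟩ := hL s hs
  rw [h s hs t ht hst.1 i (hi t hst.2.2), h' s hs t ht hst.2.1 i (hi t hst.2.2), ← mul_assoc, hQ,
    mul_assoc]

/-- Path cocycles that agree on small paths agree. -/
theorem IsPathCocycle.eq_of_eq_on_small {L L' : C(I, X) → G} (hL : IsPathCocycle L)
    (hL' : IsPathCocycle L') (hC : ∀ i, IsOpen (C i)) (hcov : ∀ x, ∃ i, x ∈ C i)
    (h : ∀ i γ, (∀ t, γ t ∈ C i) → L γ = L' γ) (γ : C(I, X)) : L γ = L' γ := by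
  obtain ⟨ε, hε, hLeb⟩ := exists_lebesgue_path hC hcov γ
  have := interval_induction (Q := fun t => L ((planeExtend γ).comp (affinePath (0, 0) (t, 0))) =
      L' ((planeExtend γ).comp (affinePath (0, 0) (t, 0)))) (by
        -- A fully degenerate triangle forces the value `1` on a constant path.
        have e1 := hL (planeExtend γ) (0, 0) (0, 0) (0, 0)
        have e2 := hL' (planeExtend γ) (0, 0) (0, 0) (0, 0)
        rw [mul_eq_left] at e1 e2
        rw [e1, e2]) hε (fun s hs t ht hst hQ => by
        obtain ⟨i, hi⟩ := hLeb s hs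
        rw [← hL (planeExtend γ) (0, 0) (s, 0) (t, 0), ← hL' (planeExtend γ) (0, 0) (s, 0) (t, 0),
          hQ, h i _ (hi t hst)])
  rwa [planeExtend_comp_affinePath] at this

/-- Local path cocycles which agree on overlaps can be glued. -/
theorem exists_isPathCocycle_of_local (hC : ∀ i, IsOpen (C i)) (hcov : ∀ x, ∃ i, x ∈ C i)
    (hM : ∀ i, IsPathCocycleOn (C i) (M i))
    (hagree : ∀ i j γ, (∀ t, γ t ∈ C i) → (∀ t, γ t ∈ C j) → M i γ = M j γ) :
    ∃ N : C(I, X) → G, IsPathCocycle N ∧ ∀ i γ, (∀ t, γ t ∈ C i) → N γ = M i γ := by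
  -- A single function on the plane restricts to primitives along all segments in the ball; hence
  -- the increments along the three sides of a triangle are compatible.
  have hex : ∀ (H : C(ℝ × ℝ, X)) (R : ℝ), ∃ g : ℝ × ℝ → G, ∀ p q, ‖p‖ ≤ R → ‖q‖ ≤ R →
      IsPrimitiveAlong C M (H.comp (affinePath p q)) fun t => g (AffineMap.lineMap p q t) := by
    intro H R
    obtain ⟨g, δ, hδ, hg⟩ := exists_local_primitive hC hcov hM hagree H R
    -- The segment stretches parameter distances by `dist p q`; adding `1` keeps the denominator
    -- positive when `p = q`.
    refine ⟨g, fun p q hp hq => ⟨δ / (dist p q + 1), by positivity, fun s hs t ht hst i hi => ?_⟩⟩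
    have hball : ∀ t ∈ Set.Icc (0 : ℝ) 1, ‖AffineMap.lineMap p q t‖ ≤ R := fun t ht => by
      have := (convex_closedBall (0 : ℝ × ℝ) R).lineMap_mem
        (show p ∈ _ by simpa using hp) (show q ∈ _ by simpa using hq) ht
      simpa using this
    have hd : dist (AffineMap.lineMap p q s) (AffineMap.lineMap p q t) < δ := by
      rw [dist_lineMap_lineMap]
      rw [lt_div_iff₀ (by positivity)] at hst
      nlinarith [dist_nonneg (x := s) (y := t), dist_nonneg (x := p) (y := q)]
    rw [planeExtend_subpath H p q hs ht]
    refine hg _ _ (hball s hs) (hball t ht) hd i fun u => ?_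
    have := hi u
    rwa [← ContinuousMap.comp_apply, planeExtend_subpath H p q hs ht] at this
  have hex' : ∀ γ : C(I, X), ∃ g : ℝ → G, IsPrimitiveAlong C M γ g := fun γ => by
    obtain ⟨g, hg⟩ := hex (planeExtend γ) 1
    have := hg (0, 0) (1, 0) (by simp) (by simp [Prod.norm_def])
    rw [planeExtend_comp_affinePath] at this
    exact ⟨_, this⟩
  choose P hP using hex'
  -- The glued cocycle is the total increment of any primitive, which is independent of the choice.
  refine ⟨fun γ => (P γ 0)⁻¹ * P γ 1, fun H p q r => ?_, fun i γ hγ => ?_⟩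
  · obtain ⟨g, hg⟩ := hex H (max ‖p‖ (max ‖q‖ ‖r‖))
    have hp : ‖p‖ ≤ max ‖p‖ (max ‖q‖ ‖r‖) := le_max_left _ _
    have hq : ‖q‖ ≤ max ‖p‖ (max ‖q‖ ‖r‖) := (le_max_left _ _).trans (le_max_right _ _)
    have hr : ‖r‖ ≤ max ‖p‖ (max ‖q‖ ‖r‖) := (le_max_right _ _).trans (le_max_right _ _)
    simp only
    rw [(hP _).unique hC hcov (hg p q hp hq), (hP _).unique hC hcov (hg q r hq hr),
      (hP _).unique hC hcov (hg p r hp hr)]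
    simp
  · have hsub : ∀ z, planeExtend γ z ∈ C i := fun z => hγ _
    have htri := hM i (planeExtend γ) Set.univ convex_univ (fun z _ => hsub z)
    -- For a path inside one `C i`, the values of `M i` on its initial segments already form a
    -- primitive.
    have := (hP γ).unique hC hcov (g' := fun t =>
      M i ((planeExtend γ).comp (affinePath (0, 0) (t, 0)))) ⟨1, one_pos, fun s hs t ht _ j hj => by
        beta_reduce
        rw [← htri (0, 0) trivial (s, 0) trivial (t, 0) trivial]
        rw [hagree i j ((planeExtend γ).comp (affinePath (s, 0) (t, 0))) (fun u => hsub _) hj]⟩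
    beta_reduce
    rw [this, planeExtend_comp_affinePath]
    have h0 := htri (0, 0) trivial (0, 0) trivial (0, 0) trivial
    rw [mul_eq_left] at h0
    simp [h0]

end PathCocycles

/-! ### Universal cocycles and the fundamental group -/

section UniversalCocycle

open scoped unitInterval

variable {X : Type*} [TopologicalSpace X] {G : Type*} [Group G]

theorem planeExtend_path {a b : X} (p : Path a b) (z : ℝ × ℝ) :
    planeExtend p.toContinuousMap z = p.extend z.1 := rfl

theorem affinePath_fst (s t : ℝ) (u : I) :
    (affinePath (s, 0) (t, 0) u).1 = (1 - (u : ℝ)) * s + u * t := by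
  simp [affinePath_apply, AffineMap.lineMap_apply_module]

namespace IsPathCocycle

variable {L : C(I, X) → G} (hL : IsPathCocycle L)
include hL

theorem trans {a b c : X} (p : Path a b) (q : Path b c) :
    L (p.trans q).toContinuousMap = L p.toContinuousMap * L q.toContinuousMap := by
  have h := hL (planeExtend (p.trans q).toContinuousMap) (0, 0) (1 / 2, 0) (1, 0)
  rw [planeExtend_comp_affinePath] at h
  rw [← h]
  congr 2
  · ext u
    rw [ContinuousMap.comp_apply, planeExtend_path, affinePath_fst,
      Path.extend_trans_of_le_half _ _ (by linarith [u.2.2])]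
    have : 2 * ((1 - (u : ℝ)) * 0 + u * (1 / 2)) = u := by ring
    rw [this, Path.extend_apply p u.2]
    rfl
  · ext u
    rw [ContinuousMap.comp_apply, planeExtend_path, affinePath_fst,
      Path.extend_trans_of_half_le _ _ (by linarith [u.2.1])]
    have : 2 * ((1 - (u : ℝ)) * (1 / 2) + u * 1) - 1 = u := by ring
    rw [this, Path.extend_apply q u.2]
    rfl

theorem refl (a : X) : L (Path.refl a).toContinuousMap = 1 := by
  have := hL (ContinuousMap.const _ a) (0, 0) (0, 0) (0, 0)
  rw [mul_eq_left] at this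
  rw [← this]
  rfl

theorem symm {a b : X} (p : Path a b) : L p.symm.toContinuousMap = (L p.toContinuousMap)⁻¹ := by
  rw [eq_inv_iff_mul_eq_one]
  have h := hL (planeExtend p.toContinuousMap) (1, 0) (0, 0) (1, 0)
  rw [planeExtend_comp_affinePath] at h
  have e1 : p.symm.toContinuousMap =
      (planeExtend p.toContinuousMap).comp (affinePath (1, 0) (0, 0)) := by
    ext u
    rw [ContinuousMap.comp_apply, planeExtend_path, affinePath_fst]
    have : (1 - (u : ℝ)) * 1 + u * 0 = (σ u : I) := by simp
    rw [this, Path.extend_apply p (σ u).2]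
    rfl
  have e2 : (planeExtend p.toContinuousMap).comp (affinePath (1, 0) (1, 0)) =
      (Path.refl b).toContinuousMap := by
    ext u
    rw [ContinuousMap.comp_apply, planeExtend_path, affinePath_fst]
    simp
  rw [e1, h, e2, hL.refl]

/-- Cut the homotopy square along a diagonal: both triangles compute the value on the diagonal, and
the two constant sides contribute `1`. -/
theorem eq_of_homotopic {a b : X} {p q : Path a b} (h : p.Homotopic q) :
    L p.toContinuousMap = L q.toContinuousMap := by
  obtain ⟨F⟩ := h
  let H : C(ℝ × ℝ, X) := ⟨fun z => F (Set.projIcc 0 1 zero_le_one z.1,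
    Set.projIcc 0 1 zero_le_one z.2), F.continuous.comp
      ((continuous_projIcc.comp continuous_fst).prodMk (continuous_projIcc.comp continuous_snd))⟩
  have hH : ∀ z, H z = F (Set.projIcc 0 1 zero_le_one z.1, Set.projIcc 0 1 zero_le_one z.2) :=
    fun _ => rfl
  have h1 := hL H (0, 0) (0, 1) (1, 1)
  have h2 := hL H (0, 0) (1, 0) (1, 1)
  have e1 : H.comp (affinePath (0, 0) (0, 1)) = p.toContinuousMap := by
    ext u
    simp [hH, affinePath_apply, AffineMap.lineMap_apply_module]
  have e2 : H.comp (affinePath (0, 1) (1, 1)) = (Path.refl b).toContinuousMap := by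
    ext u
    simp [hH, affinePath_apply, AffineMap.lineMap_apply_module]
  have e3 : H.comp (affinePath (0, 0) (1, 0)) = (Path.refl a).toContinuousMap := by
    ext u
    simp [hH, affinePath_apply, AffineMap.lineMap_apply_module]
  have e4 : H.comp (affinePath (1, 0) (1, 1)) = q.toContinuousMap := by
    ext u
    simp [hH, affinePath_apply, AffineMap.lineMap_apply_module]
  rw [e1, e2, hL.refl, mul_one] at h1
  rw [e3, e4, hL.refl, one_mul] at h2
  rw [h1, h2]

end IsPathCocycle

/-- A path cocycle that identifies the homotopy classes of paths between any two points with the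
group. -/
structure IsUniversalCocycle (L : C(I, X) → G) : Prop where
  isPathCocycle : IsPathCocycle L
  homotopic : ∀ {a b : X} (p q : Path a b), L p.toContinuousMap = L q.toContinuousMap →
    p.Homotopic q
  exists_path : ∀ (a b : X) (g : G), ∃ p : Path a b, L p.toContinuousMap = g

/-- Change of a path cocycle by a function on the space. -/
def gauge (s : X → G) (L : C(I, X) → G) (γ : C(I, X)) : G := (s (γ 0))⁻¹ * L γ * s (γ 1)

theorem gauge_path (s : X → G) (L : C(I, X) → G) {a b : X} (p : Path a b) :
    gauge s L p.toContinuousMap = (s a)⁻¹ * L p.toContinuousMap * s b := by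
  simp [gauge]

theorem affinePath_zero (p q : ℝ × ℝ) : affinePath p q 0 = p := by simp [affinePath_apply]

theorem affinePath_one (p q : ℝ × ℝ) : affinePath p q 1 = q := by simp [affinePath_apply]

theorem IsUniversalCocycle.gauge {L : C(I, X) → G} (hL : IsUniversalCocycle L) (s : X → G) :
    IsUniversalCocycle (gauge s L) where
  isPathCocycle H p q r := by
    simp only [FCAGraph.gauge, ContinuousMap.comp_apply, affinePath_zero, affinePath_one]
    rw [← hL.isPathCocycle H p q r]
    group
  homotopic p q h := hL.homotopic p q (by simpa [gauge_path] using h)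
  exists_path a b g := by
    obtain ⟨p, hp⟩ := hL.exists_path a b (s a * g * (s b)⁻¹)
    exact ⟨p, by rw [gauge_path, hp]; group⟩

/-- Paths are closed up to loops at `x₀` by fixed connecting paths `α`. The inverse is needed
because multiplication in `FundamentalGroup` reverses concatenation; triangles give relations
because the plane is simply connected. -/
theorem exists_isUniversalCocycle [PathConnectedSpace X] (x₀ : X)
    (e : FundamentalGroup X x₀ ≃* G) : ∃ L : C(I, X) → G, IsUniversalCocycle L := by
  let α : ∀ x : X, Path x₀ x := fun x => PathConnectedSpace.somePath x₀ x
  let cls : ∀ {a b : X}, Path a b → Path.Homotopic.Quotient x₀ x₀ := fun {a b} p =>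
    ((Path.Homotopic.Quotient.mk (α a)).trans (Path.Homotopic.Quotient.mk p)).trans
      (Path.Homotopic.Quotient.mk (α b)).symm
  let L : C(I, X) → G := fun γ =>
    e (FundamentalGroup.fromPath (cls (⟨γ, rfl, rfl⟩ : Path (γ 0) (γ 1))))⁻¹
  have hLp : ∀ {a b : X} (p : Path a b),
      L p.toContinuousMap = e (FundamentalGroup.fromPath (cls p))⁻¹ := by
    intro a b p
    obtain ⟨γ, h0, h1⟩ := p
    subst h0 h1
    rfl
  have htrans : ∀ {a b c : X} (p : Path a b) (q : Path b c),
      (cls p).trans (cls q) = cls (p.trans q) := by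
    intro a b c p q
    simp only [cls, Path.Homotopic.Quotient.mk_trans]
    grind
  refine ⟨L, fun H p q r => ?_, fun {a b} p q h => ?_, fun a b g => ?_⟩
  · let seg : ∀ p q : ℝ × ℝ, Path p q := fun p q =>
      ⟨affinePath p q, affinePath_zero p q, affinePath_one p q⟩
    have hseg : ∀ p q, L (H.comp (affinePath p q)) =
        e (FundamentalGroup.fromPath (cls ((seg p q).map H.continuous)))⁻¹ :=
      fun p q => hLp ((seg p q).map H.continuous)
    have hom : ((seg p q).map H.continuous).trans ((seg q r).map H.continuous) |>.Homotopic
        ((seg p r).map H.continuous) := by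
      rw [← Path.map_trans]
      exact (SimplyConnectedSpace.paths_homotopic ((seg p q).trans (seg q r)) (seg p r)).map H
    rw [hseg, hseg, hseg, ← map_mul, ← mul_inv_rev, FundamentalGroup.mul_def]
    congr 2
    change (cls _).trans (cls _) = _
    rw [htrans]
    simp only [cls, Path.Homotopic.Quotient.eq.2 hom]
  · rw [hLp, hLp] at h
    have h' : cls p = cls q := (inv_inj (G := FundamentalGroup X x₀)).1 (e.injective h)
    refine Path.Homotopic.Quotient.exact ?_
    have : ∀ r : Path a b, Path.Homotopic.Quotient.mk r =
      ((Path.Homotopic.Quotient.mk (α a)).symm.trans (cls r)).trans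
        (Path.Homotopic.Quotient.mk (α b)) := fun r => by
      simp only [cls]; grind
    rw [this p, this q, h']
  · obtain ⟨p, hp⟩ := Path.Homotopic.Quotient.mk_surjective
      (FundamentalGroup.toPath (e.symm g)⁻¹)
    refine ⟨((α a).symm.trans p).trans (α b), ?_⟩
    rw [hLp]
    have : cls (((α a).symm.trans p).trans (α b)) = Path.Homotopic.Quotient.mk p := by
      simp only [cls, Path.Homotopic.Quotient.mk_trans, Path.Homotopic.Quotient.mk_symm]
      grind
    rw [this, hp]
    change e ((e.symm g)⁻¹)⁻¹ = g
    simp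

/-! ### Groups of loops in a subset -/

/-- The classes of the loops in `C` with base point `b`. -/
def loopSubgroup (C : Set X) {b : X} (hb : b ∈ C) : Subgroup (FundamentalGroup X b) where
  carrier := {x | ∃ q : Path b b, (∀ t, q t ∈ C) ∧
    x = FundamentalGroup.fromPath (Path.Homotopic.Quotient.mk q)}
  one_mem' := ⟨Path.refl b, fun _ => hb, rfl⟩
  mul_mem' := by
    rintro _ _ ⟨p, hp, rfl⟩ ⟨q, hq, rfl⟩
    refine ⟨q.trans p, fun t => ?_, rfl⟩
    rw [Path.trans_apply]
    split_ifs
    exacts [hq _, hp _]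
  inv_mem' := by
    rintro _ ⟨p, hp, rfl⟩
    exact ⟨p.symm, fun t => hp _, rfl⟩

/-- The values of a path cocycle on the loops in `C` with base point `b`. -/
def loopValues {L : C(I, X) → G} (hL : IsPathCocycle L) (C : Set X) {b : X} (hb : b ∈ C) :
    Subgroup G where
  carrier := {g | ∃ q : Path b b, (∀ t, q t ∈ C) ∧ L q.toContinuousMap = g}
  one_mem' := ⟨Path.refl b, fun _ => hb, hL.refl b⟩
  mul_mem' := by
    rintro _ _ ⟨p, hp, rfl⟩ ⟨q, hq, rfl⟩
    refine ⟨p.trans q, fun t => ?_, hL.trans p q⟩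
    rw [Path.trans_apply]
    split_ifs
    exacts [hp _, hq _]
  inv_mem' := by
    rintro _ ⟨p, hp, rfl⟩
    exact ⟨p.symm, fun t => hp _, hL.symm p⟩

/-- Evaluation of a path cocycle on homotopy classes of loops. The inverse makes up for the order
of the multiplication in `FundamentalGroup`. -/
def loopHom {L : C(I, X) → G} (hL : IsPathCocycle L) (b : X) : FundamentalGroup X b →* G :=
  MonoidHom.mk' (fun x => Quotient.lift (s := Path.Homotopic.setoid b b)
      (fun p : Path b b => (L p.toContinuousMap)⁻¹)
      (fun p q h => by rw [hL.eq_of_homotopic h]) (FundamentalGroup.toPath x)) (by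
    intro x y
    obtain ⟨p, rfl⟩ := Path.Homotopic.Quotient.mk_surjective x
    obtain ⟨q, rfl⟩ := Path.Homotopic.Quotient.mk_surjective y
    change (L (q.trans p).toContinuousMap)⁻¹ = (L p.toContinuousMap)⁻¹ * (L q.toContinuousMap)⁻¹
    rw [hL.trans, mul_inv_rev])

theorem loopHom_mk {L : C(I, X) → G} (hL : IsPathCocycle L) {b : X} (p : Path b b) :
    loopHom hL b (FundamentalGroup.fromPath (Path.Homotopic.Quotient.mk p)) =
      (L p.toContinuousMap)⁻¹ := rfl

/-- Universality makes `loopHom` injective, and reversing loops absorbs its inverse. -/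
theorem nonempty_loopValues_mulEquiv {L : C(I, X) → G} (hL : IsUniversalCocycle L) (C : Set X)
    {b : X} (hb : b ∈ C) :
    Nonempty (loopValues hL.isPathCocycle C hb ≃* loopSubgroup C hb) := by
  have hinj : Function.Injective (loopHom hL.isPathCocycle b) := by
    intro x y h
    obtain ⟨p, rfl⟩ := Path.Homotopic.Quotient.mk_surjective x
    obtain ⟨q, rfl⟩ := Path.Homotopic.Quotient.mk_surjective y
    exact Path.Homotopic.Quotient.eq.2 (hL.homotopic p q (inv_injective h))
  have hmap : (loopSubgroup C hb).map (loopHom hL.isPathCocycle b) =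
      loopValues hL.isPathCocycle C hb := by
    ext g
    constructor
    · rintro ⟨_, ⟨q, hq, rfl⟩, rfl⟩
      exact inv_mem (show L q.toContinuousMap ∈ loopValues hL.isPathCocycle C hb from ⟨q, hq, rfl⟩)
    · rintro ⟨q, hq, rfl⟩
      exact ⟨_, ⟨q.symm, fun t => hq _, rfl⟩, by
        rw [loopHom_mk, hL.isPathCocycle.symm, inv_inv]⟩
  rw [← hmap]
  exact ⟨((loopSubgroup C hb).equivMapOfInjective _ hinj).symm⟩

end UniversalCocycle

/-! ### Maximal trees -/

section Trees

variable {𝒱 ℰ : Type*}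

/-- `v` and `w` are joined by a path with edges in `T`. -/
def EdgeJoined (o : ℰ → Bool → 𝒱) (T : Set ℰ) (v w : 𝒱) : Prop :=
  Relation.ReflTransGen (fun a b => ∃ e ∈ T, ∃ c, o e c = a ∧ o e (!c) = b) v w

/-- No edge of `T` joins vertices that are joined by the other edges of `T`. -/
def IsForest (o : ℰ → Bool → 𝒱) (T : Set ℰ) : Prop :=
  ∀ e ∈ T, ¬ EdgeJoined o (T \ {e}) (o e true) (o e false)

variable {o : ℰ → Bool → 𝒱}

theorem EdgeJoined.symm {T : Set ℰ} {v w : 𝒱} (h : EdgeJoined o T v w) : EdgeJoined o T w v := by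
  induction h with
  | refl => exact .refl
  | tail _ h ih =>
    obtain ⟨e, he, c, h1, h2⟩ := h
    exact .head ⟨e, he, !c, h2, by rwa [Bool.not_not]⟩ ih

theorem EdgeJoined.mono {T T' : Set ℰ} (hT : T ⊆ T') {v w : 𝒱} (h : EdgeJoined o T v w) :
    EdgeJoined o T' v w := by
  induction h with
  | refl => exact .refl
  | tail _ h ih =>
    obtain ⟨e, he, h⟩ := h
    exact .tail ih ⟨e, hT he, h⟩

/-- Take an inclusion-minimal edge set that joins all vertices: an edge whose ends are joined by the
others could be dropped. -/
theorem exists_maximal_tree [Finite ℰ] (hconn : ∀ v w, EdgeJoined o Set.univ v w) :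
    ∃ T : Set ℰ, (∀ v w, EdgeJoined o T v w) ∧ IsForest o T := by
  obtain ⟨T, hT⟩ := (Set.toFinite {T : Set ℰ | ∀ v w, EdgeJoined o T v w}).exists_minimal
    ⟨Set.univ, hconn⟩
  refine ⟨T, hT.prop, fun e he hj => ?_⟩
  have hmem : ∀ v w, EdgeJoined o (T \ {e}) v w := by
    intro v w
    have h := hT.prop v w
    induction h with
    | refl => exact .refl
    | tail _ hstep ih =>
      obtain ⟨e', he', c, rfl, rfl⟩ := hstep
      refine Relation.ReflTransGen.trans ih ?_
      by_cases hee : e' = e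
      · subst hee
        cases c
        exacts [hj.symm, hj]
      · exact .single ⟨e', ⟨he', hee⟩, c, rfl, rfl⟩
  exact (hT.le_of_le hmem Set.sdiff_subset he).2 rfl

/-- Edges are added one at a time. A new edge joins different components of the forest so far, so
`s` can be corrected by `k` on the component of its far end. An old edge has both ends or neither in
that component, so its relation is at most conjugated by `k`. -/
theorem exists_potential {G : Type*} [Group G] [Finite ℰ] (a : ℰ → G) (T : Set ℰ)
    (hT : IsForest o T) :
    ∃ s : 𝒱 → G, ∀ e ∈ T, (s (o e true))⁻¹ * a e * s (o e false) = 1 := by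
  classical
  induction T, Set.toFinite T using Set.Finite.induction_on with
  | empty => exact ⟨1, fun e he => he.elim⟩
  | @insert e T heT _ ih =>
    obtain ⟨s, hs⟩ := ih fun e' he' hj => hT e' (Set.mem_insert_of_mem _ he')
      (hj.mono (Set.sdiff_subset_sdiff_left (Set.subset_insert _ _)))
    have hne : ¬ EdgeJoined o T (o e false) (o e true) := fun hj => by
      refine hT e (Set.mem_insert _ _) ?_
      rw [Set.insert_sdiff_self_of_notMem heT]
      exact hj.symm
    let k := (s (o e false))⁻¹ * (a e)⁻¹ * s (o e true)
    refine ⟨fun w => if EdgeJoined o T (o e false) w then s w * k else s w, ?_⟩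
    rintro e' (rfl | he')
    · beta_reduce
      rw [if_neg hne, if_pos (show EdgeJoined o T (o e' false) (o e' false) from .refl)]
      simp only [k]
      group
    · have hiff : EdgeJoined o T (o e false) (o e' true) ↔
          EdgeJoined o T (o e false) (o e' false) :=
        ⟨fun h => .tail h ⟨e', he', true, rfl, rfl⟩, fun h => .tail h ⟨e', he', false, rfl, rfl⟩⟩
      have := hs e' he'
      by_cases h : EdgeJoined o T (o e false) (o e' false)
      · simp only [if_pos (hiff.2 h), if_pos h]
        calc _ = k⁻¹ * ((s (o e' true))⁻¹ * a e' * s (o e' false)) * k := by group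
          _ = 1 := by rw [this]; group
      · simp only [if_neg (mt hiff.1 h), if_neg h, this]

end Trees

/-! ### Spaces covered by vertex spaces that meet in edge spaces -/

section Decomposition

open scoped unitInterval

/-- A cover of `X` by path connected open sets, the vertex spaces, such that no three of them have
a common point and the intersections of two of them are disjoint unions of path connected open
sets, the edge spaces. -/
structure SpaceDecomposition (X : Type*) [TopologicalSpace X] (𝒱 ℰ : Type) where
  origin : ℰ → Bool → 𝒱
  vSpace : 𝒱 → Set X
  eSpace : ℰ → Set X
  isOpen_vSpace : ∀ i, IsOpen (vSpace i)
  isOpen_eSpace : ∀ j, IsOpen (eSpace j)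
  isPathConnected_vSpace : ∀ i, IsPathConnected (vSpace i)
  isPathConnected_eSpace : ∀ j, IsPathConnected (eSpace j)
  cover : ∀ x, ∃ i, x ∈ vSpace i
  eSpace_subset : ∀ j c, eSpace j ⊆ vSpace (origin j c)
  origin_ne : ∀ j, origin j true ≠ origin j false
  eSpace_disjoint : ∀ {j j' x}, x ∈ eSpace j → x ∈ eSpace j' → j = j'
  exists_eSpace : ∀ {i i' x}, x ∈ vSpace i → x ∈ vSpace i' → i ≠ i' → ∃ j, x ∈ eSpace j
  exists_origin : ∀ {j i x}, x ∈ eSpace j → x ∈ vSpace i → ∃ c, origin j c = i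
  vBase : 𝒱 → X
  vBase_mem : ∀ i, vBase i ∈ vSpace i
  vBase_notMem : ∀ i j, vBase i ∉ eSpace j
  eBase : ℰ → X
  eBase_mem : ∀ j, eBase j ∈ eSpace j

namespace SpaceDecomposition

variable {X : Type*} [TopologicalSpace X] {𝒱 ℰ : Type} (D : SpaceDecomposition X 𝒱 ℰ)

theorem eq_of_vSpace {i i' : 𝒱} {x : X} (h : x ∈ D.vSpace i) (h' : x ∈ D.vSpace i')
    (hx : ∀ j, x ∉ D.eSpace j) : i = i' := by
  by_contra hne
  obtain ⟨j, hj⟩ := D.exists_eSpace h h' hne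
  exact hx j hj

/-- The vertex spaces reachable from `v` and the unreachable ones have open unions covering `X`. By
connectedness the unions meet, and a common point lies in an edge space joining the two kinds. -/
theorem edgeJoined [PreconnectedSpace X] (v w : 𝒱) : EdgeJoined D.origin Set.univ v w := by
  by_contra hvw
  obtain ⟨x, -, hx, hx'⟩ := isPreconnected_univ (α := X)
    (⋃ i ∈ {i | EdgeJoined D.origin Set.univ v i}, D.vSpace i)
    (⋃ i ∈ {i | ¬ EdgeJoined D.origin Set.univ v i}, D.vSpace i)
    (isOpen_biUnion fun i _ => D.isOpen_vSpace i) (isOpen_biUnion fun i _ => D.isOpen_vSpace i)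
    (fun x _ => by
      obtain ⟨i, hi⟩ := D.cover x
      by_cases h : EdgeJoined D.origin Set.univ v i
      · exact Or.inl (Set.mem_biUnion h hi)
      · exact Or.inr (Set.mem_biUnion h hi))
    ⟨D.vBase v, trivial, Set.mem_biUnion Relation.ReflTransGen.refl (D.vBase_mem v)⟩
    ⟨D.vBase w, trivial, Set.mem_biUnion hvw (D.vBase_mem w)⟩
  simp only [Set.mem_iUnion, Set.mem_ofPred_eq] at hx hx'
  obtain ⟨i, hvi, hi⟩ := hx
  obtain ⟨i', hvi', hi'⟩ := hx'
  have hne : i ≠ i' := by rintro rfl; exact hvi' hvi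
  obtain ⟨j, hj⟩ := D.exists_eSpace hi hi' hne
  obtain ⟨c, rfl⟩ := D.exists_origin hj hi
  obtain ⟨c', rfl⟩ := D.exists_origin hj hi'
  have hc : c' = !c := by
    cases c <;> cases c' <;> simp at hne ⊢
  exact hvi' (.tail hvi ⟨j, trivial, c, rfl, by rw [hc]⟩)

/-- The edge spaces are open and disjoint, so a connected set covered by them stays in one. -/
theorem exists_eSpace_of_path {i i' : 𝒱} (hne : i ≠ i') (γ : C(I, X))
    (h : ∀ t, γ t ∈ D.vSpace i) (h' : ∀ t, γ t ∈ D.vSpace i') : ∃ j, ∀ t, γ t ∈ D.eSpace j := by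
  obtain ⟨j, hj⟩ := D.exists_eSpace (h 0) (h' 0) hne
  refine ⟨j, fun t => ?_⟩
  by_contra ht
  obtain ⟨x, ⟨s, rfl⟩, hx, hx'⟩ := (isPreconnected_range γ.continuous)
    (D.eSpace j) (⋃ k ∈ {k | k ≠ j}, D.eSpace k) (D.isOpen_eSpace j)
    (isOpen_biUnion fun k _ => D.isOpen_eSpace k)
    (by
      rintro _ ⟨s, rfl⟩
      obtain ⟨k, hk⟩ := D.exists_eSpace (h s) (h' s) hne
      by_cases hkj : k = j
      · exact Or.inl (hkj ▸ hk)
      · exact Or.inr (Set.mem_biUnion hkj hk))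
    ⟨γ 0, ⟨0, rfl⟩, hj⟩
    (by
      obtain ⟨k, hk⟩ := D.exists_eSpace (h t) (h' t) hne
      exact ⟨γ t, ⟨t, rfl⟩, Set.mem_biUnion (show k ≠ j by rintro rfl; exact ht hk) hk⟩)
  simp only [Set.mem_iUnion, Set.mem_ofPred_eq] at hx'
  obtain ⟨k, hkj, hk⟩ := hx'
  exact hkj (D.eSpace_disjoint hk hx)

open Classical in
/-- The value `f j` at the points of the edge space of `j` seen from the far vertex space, and `1`
otherwise. -/
def twist {A : Type*} [One A] (f : ℰ → A) (i : 𝒱) (x : X) : A :=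
  if h : ∃ j, x ∈ D.eSpace j ∧ D.origin j false = i then f h.choose else 1

section Twist

variable {A : Type*} [Group A] (f : ℰ → A)

theorem twist_false {j : ℰ} {x : X} (hx : x ∈ D.eSpace j) :
    D.twist f (D.origin j false) x = f j := by
  have h : ∃ j', x ∈ D.eSpace j' ∧ D.origin j' false = D.origin j false := ⟨j, hx, rfl⟩
  rw [twist, dif_pos h, D.eSpace_disjoint h.choose_spec.1 hx]

theorem twist_true {j : ℰ} {x : X} (hx : x ∈ D.eSpace j) :
    D.twist f (D.origin j true) x = 1 := by
  rw [twist, dif_neg]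
  rintro ⟨j', hj', h⟩
  obtain rfl := D.eSpace_disjoint hj' hx
  exact D.origin_ne j' h.symm

theorem twist_of_notMem {x : X} (hx : ∀ j, x ∉ D.eSpace j) (i : 𝒱) : D.twist f i x = 1 := by
  rw [twist, dif_neg]
  rintro ⟨j, hj, -⟩
  exact hx j hj

theorem map_twist {B : Type*} [Group B] (φ : A →* B) (i : 𝒱) (x : X) :
    φ (D.twist f i x) = D.twist (fun j => φ (f j)) i x := by
  simp only [twist]
  split_ifs <;> simp

end Twist

/-! ### Normalization along a tree -/

variable {G : Type u} [Group G]

/-- A universal cocycle that is trivial on suitable paths in the vertex and edge spaces and along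
the tree `T`, and has the value `g j` on the passage through the edge `j`. -/
structure IsNormalized (L : C(I, X) → G) (g : ℰ → G) (T : Set ℰ) : Prop where
  isUniversalCocycle : IsUniversalCocycle L
  path_vSpace : ∀ i x, x ∈ D.vSpace i → (∀ j, x ∉ D.eSpace j) →
    ∃ p : Path (D.vBase i) x, (∀ t, p t ∈ D.vSpace i) ∧ L p.toContinuousMap = 1
  path_eSpace : ∀ j x, x ∈ D.eSpace j →
    ∃ p : Path (D.eBase j) x, (∀ t, p t ∈ D.eSpace j) ∧ L p.toContinuousMap = 1
  path_true : ∀ j, ∃ p : Path (D.vBase (D.origin j true)) (D.eBase j),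
    (∀ t, p t ∈ D.vSpace (D.origin j true)) ∧ L p.toContinuousMap = 1
  path_false : ∀ j, ∃ p : Path (D.vBase (D.origin j false)) (D.eBase j),
    (∀ t, p t ∈ D.vSpace (D.origin j false)) ∧ L p.toContinuousMap = g j
  tree : ∀ j ∈ T, g j = 1

theorem exists_path_of_isPathConnected {S : Set X} (hS : IsPathConnected S) {x y : X}
    (hx : x ∈ S) (hy : y ∈ S) : ∃ p : Path x y, ∀ t, p t ∈ S := by
  obtain ⟨p, hp⟩ := hS.joinedIn x hx y hy
  exact ⟨p, hp⟩

/-- A gauge transformation has a free value at every point. At the vertex base points it is a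
potential that trivializes the tree edges; at an edge base point it trivializes the passage from the
`true` side; elsewhere it trivializes a chosen path from the base point of the piece. -/
theorem exists_isNormalized [Finite ℰ] {L₀ : C(I, X) → G} (hL₀ : IsUniversalCocycle L₀)
    {T : Set ℰ} (hT : IsForest D.origin T) : ∃ (L : C(I, X) → G) (g : ℰ → G), D.IsNormalized L g T := by
  have hρ : ∀ j c, ∃ p : Path (D.vBase (D.origin j c)) (D.eBase j),
      ∀ t, p t ∈ D.vSpace (D.origin j c) := fun j c =>
    exists_path_of_isPathConnected (D.isPathConnected_vSpace _) (D.vBase_mem _)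
      (D.eSpace_subset j c (D.eBase_mem j))
  choose ρ hρ using hρ
  obtain ⟨s, hs⟩ := exists_potential (fun j => L₀ (ρ j true).toContinuousMap *
    (L₀ (ρ j false).toContinuousMap)⁻¹) T hT
  -- `z` is the gauge value at `x`. The clauses about base points use that the chosen path is
  -- constant there, which pins `z` down.
  have hk : ∀ x, ∃ z : G, (∀ i, x ∈ D.vSpace i → (∀ j, x ∉ D.eSpace j) →
        (∃ p : Path (D.vBase i) x, (∀ t, p t ∈ D.vSpace i) ∧
          (s i)⁻¹ * L₀ p.toContinuousMap * z = 1) ∧ (D.vBase i = x → z = s i)) ∧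
      ∀ j, x ∈ D.eSpace j → (∃ p : Path (D.eBase j) x, (∀ t, p t ∈ D.eSpace j) ∧
          z = (L₀ p.toContinuousMap)⁻¹ * (L₀ (ρ j true).toContinuousMap)⁻¹ *
            s (D.origin j true)) ∧
        (D.eBase j = x → z = (L₀ (ρ j true).toContinuousMap)⁻¹ * s (D.origin j true)) := by
    intro x
    by_cases hx : ∃ j, x ∈ D.eSpace j
    · obtain ⟨j, hj⟩ := hx
      obtain ⟨p, hp, hp1⟩ : ∃ p : Path (D.eBase j) x, (∀ t, p t ∈ D.eSpace j) ∧
          (D.eBase j = x → L₀ p.toContinuousMap = 1) := by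
        by_cases h : D.eBase j = x
        · subst h
          exact ⟨Path.refl _, fun _ => hj, fun _ => hL₀.isPathCocycle.refl _⟩
        · obtain ⟨p, hp⟩ := exists_path_of_isPathConnected (D.isPathConnected_eSpace j)
            (D.eBase_mem j) hj
          exact ⟨p, hp, fun h' => (h h').elim⟩
      refine ⟨(L₀ p.toContinuousMap)⁻¹ * (L₀ (ρ j true).toContinuousMap)⁻¹ *
        s (D.origin j true), fun i _ hi => (hi j hj).elim, fun j' hj' => ?_⟩
      obtain rfl := D.eSpace_disjoint hj hj'
      exact ⟨⟨p, hp, rfl⟩, fun h => by rw [hp1 h]; group⟩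
    · push Not at hx
      obtain ⟨i, hi⟩ := D.cover x
      obtain ⟨p, hp, hp1⟩ : ∃ p : Path (D.vBase i) x, (∀ t, p t ∈ D.vSpace i) ∧
          (D.vBase i = x → L₀ p.toContinuousMap = 1) := by
        by_cases h : D.vBase i = x
        · subst h
          exact ⟨Path.refl _, fun _ => hi, fun _ => hL₀.isPathCocycle.refl _⟩
        · obtain ⟨p, hp⟩ := exists_path_of_isPathConnected (D.isPathConnected_vSpace i)
            (D.vBase_mem i) hi
          exact ⟨p, hp, fun h' => (h h').elim⟩
      refine ⟨(L₀ p.toContinuousMap)⁻¹ * s i, fun i' hi' _ => ?_, fun j hj => (hx j hj).elim⟩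
      obtain rfl := D.eq_of_vSpace hi hi' hx
      exact ⟨⟨p, hp, by group⟩, fun h => by rw [hp1 h]; group⟩
  choose k hk using hk
  have hv : ∀ i, k (D.vBase i) = s i := fun i =>
    ((hk _).1 i (D.vBase_mem i) (D.vBase_notMem i)).2 rfl
  have he : ∀ j, k (D.eBase j) = (L₀ (ρ j true).toContinuousMap)⁻¹ * s (D.origin j true) :=
    fun j => ((hk _).2 j (D.eBase_mem j)).2 rfl
  refine ⟨gauge k L₀, fun j => gauge k L₀ (ρ j false).toContinuousMap,
    hL₀.gauge k, fun i x hx hx' => ?_, fun j x hx => ?_, fun j => ⟨ρ j true, hρ j true, ?_⟩,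
    fun j => ⟨ρ j false, hρ j false, rfl⟩, fun j hj => ?_⟩
  · obtain ⟨p, hp, h⟩ := ((hk x).1 i hx hx').1
    exact ⟨p, hp, by rw [gauge_path, hv, h]⟩
  · obtain ⟨p, hp, h⟩ := ((hk x).2 j hx).1
    exact ⟨p, hp, by rw [gauge_path, he, h]; group⟩
  · rw [gauge_path, hv, he]
    group
  · have := hs j hj
    rw [gauge_path, hv, he, ← inv_eq_one, ← this]
    group

end SpaceDecomposition
end Decomposition

/-! ### Vertex and edge groups of a decomposition -/

section

open scoped unitInterval

namespace SpaceDecomposition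

variable {X : Type*} [TopologicalSpace X] {𝒱 ℰ : Type} {D : SpaceDecomposition X 𝒱 ℰ}
  {G : Type u} [Group G]

namespace IsNormalized

variable {L : C(I, X) → G} {g : ℰ → G} {T : Set ℰ} (hN : D.IsNormalized L g T)
include hN

theorem isPathCocycle : IsPathCocycle L := hN.isUniversalCocycle.isPathCocycle

/-- The vertex groups as subgroups of `G`. -/
def vSubgroup (i : 𝒱) : Subgroup G := loopValues hN.isPathCocycle (D.vSpace i) (D.vBase_mem i)

/-- The edge groups as subgroups of `G`. -/
def eSubgroup (j : ℰ) : Subgroup G := loopValues hN.isPathCocycle (D.eSpace j) (D.eBase_mem j)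

theorem loop_mem_vSubgroup {i : 𝒱} {x y : X} {p : Path (D.vBase i) x} {q : Path x y}
    {r : Path (D.vBase i) y} (hp : ∀ t, p t ∈ D.vSpace i) (hq : ∀ t, q t ∈ D.vSpace i)
    (hr : ∀ t, r t ∈ D.vSpace i) :
    L p.toContinuousMap * L q.toContinuousMap * (L r.toContinuousMap)⁻¹ ∈ hN.vSubgroup i := by
  refine ⟨(p.trans q).trans r.symm, fun t => ?_, ?_⟩
  · rw [Path.trans_apply]
    split_ifs
    · rw [Path.trans_apply]
      split_ifs
      exacts [hp _, hq _]
    · exact hr _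
  · rw [hN.isPathCocycle.trans, hN.isPathCocycle.trans, hN.isPathCocycle.symm]

theorem eSubgroup_le (j : ℰ) : hN.eSubgroup j ≤ hN.vSubgroup (D.origin j true) := by
  rintro _ ⟨q, hq, rfl⟩
  obtain ⟨p, hp, hp1⟩ := hN.path_true j
  have := hN.loop_mem_vSubgroup hp (fun t => D.eSpace_subset j true (hq t)) hp
  simpa [hp1] using this

theorem conj_mem (j : ℰ) {h : G} (hh : h ∈ hN.eSubgroup j) :
    g j * h * (g j)⁻¹ ∈ hN.vSubgroup (D.origin j false) := by
  obtain ⟨q, hq, rfl⟩ := hh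
  obtain ⟨p, hp, hp1⟩ := hN.path_false j
  have := hN.loop_mem_vSubgroup hp (fun t => D.eSpace_subset j false (hq t)) hp
  rwa [hp1] at this

/-- The inclusions of the edge groups. -/
def edgeIncl (j : ℰ) : ∀ c : Bool, hN.eSubgroup j →* hN.vSubgroup (D.origin j c)
  | true => Subgroup.inclusion (hN.eSubgroup_le j)
  | false => MonoidHom.mk' (fun h => ⟨g j * h * (g j)⁻¹, hN.conj_mem j h.2⟩)
      (fun a b => Subtype.ext (by simp))

theorem edgeIncl_injective (j : ℰ) (c : Bool) : Function.Injective (hN.edgeIncl j c) := by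
  cases c
  · intro a b h
    exact Subtype.ext (mul_left_cancel (mul_right_cancel (congrArg Subtype.val h)))
  · exact Subgroup.inclusion_injective (hN.eSubgroup_le j)

/-- The graph of groups of a decomposition. -/
abbrev graphOfGroups [Finite 𝒱] [Finite ℰ] [Nonempty 𝒱] [PreconnectedSpace X] :
    GraphOfGroups.{u} where
  Vert := 𝒱
  Edge := ℰ
  origin := D.origin
  connected v w := by
    have h := D.edgeJoined v w
    induction h with
    | refl => exact .refl
    | tail _ h ih =>
      obtain ⟨e, -, h⟩ := h
      exact .tail ih ⟨e, h⟩
  vGroup i := hN.vSubgroup i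
  eGroup j := hN.eSubgroup j
  incl := hN.edgeIncl
  incl_injective := hN.edgeIncl_injective

/-- A point of an edge space is reached through the edge base point, and this passage costs `1` from
the `true` end and `g j` from the `false` end. The twist records that cost. -/
theorem exists_path_twist {i : 𝒱} {x : X} (hx : x ∈ D.vSpace i) :
    ∃ p : Path (D.vBase i) x, (∀ t, p t ∈ D.vSpace i) ∧ L p.toContinuousMap = D.twist g i x := by
  by_cases h : ∀ j, x ∉ D.eSpace j
  · rw [D.twist_of_notMem g h]
    exact hN.path_vSpace i x hx h
  · push Not at h
    obtain ⟨j, hj⟩ := h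
    obtain ⟨c, rfl⟩ := D.exists_origin hj hx
    obtain ⟨q, hq, hq1⟩ := hN.path_eSpace j x hj
    obtain ⟨p, hp, hp1⟩ : ∃ p : Path (D.vBase (D.origin j c)) (D.eBase j),
        (∀ t, p t ∈ D.vSpace (D.origin j c)) ∧
          L p.toContinuousMap = D.twist g (D.origin j c) x := by
      cases c
      · rw [D.twist_false g hj]; exact hN.path_false j
      · rw [D.twist_true g hj]; exact hN.path_true j
    refine ⟨p.trans q, fun t => ?_, by rw [hN.isPathCocycle.trans, hp1, hq1, mul_one]⟩
    rw [Path.trans_apply]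
    split_ifs
    exacts [hp _, D.eSpace_subset j c (hq _)]

/-- This is the value of `L` on the loop that goes out to `γ 0`, along `γ`, and back to the vertex
base point. -/
theorem twist_mul_mem {i : 𝒱} {γ : C(I, X)} (hγ : ∀ t, γ t ∈ D.vSpace i) :
    D.twist g i (γ 0) * L γ * (D.twist g i (γ 1))⁻¹ ∈ hN.vSubgroup i := by
  obtain ⟨p, hp, hp1⟩ := hN.exists_path_twist (hγ 0)
  obtain ⟨r, hr, hr1⟩ := hN.exists_path_twist (hγ 1)
  rw [← hp1, ← hr1]
  exact hN.loop_mem_vSubgroup (q := ⟨γ, rfl, rfl⟩) hp hγ hr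

theorem mem_eSubgroup {j : ℰ} {γ : C(I, X)} (hγ : ∀ t, γ t ∈ D.eSpace j) :
    L γ ∈ hN.eSubgroup j := by
  obtain ⟨p, hp, hp1⟩ := hN.path_eSpace j _ (hγ 0)
  obtain ⟨r, hr, hr1⟩ := hN.path_eSpace j _ (hγ 1)
  refine ⟨(p.trans (⟨γ, rfl, rfl⟩ : Path (γ 0) (γ 1))).trans r.symm, fun t => ?_, ?_⟩
  · rw [Path.trans_apply]
    split_ifs
    · rw [Path.trans_apply]
      split_ifs
      exacts [hp _, hγ _]
    · exact hr _
  · rw [hN.isPathCocycle.trans, hN.isPathCocycle.trans, hN.isPathCocycle.symm, hp1, hr1]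
    simp

/-! ### Comparison with the fundamental group of the graph of groups -/

section Iso

variable [Finite 𝒱] [Finite ℰ] [Nonempty 𝒱] [PreconnectedSpace X]

/-- The vertex groups in the fundamental group of the graph of groups. -/
def vHom (i : 𝒱) : hN.vSubgroup i →* hN.graphOfGroups.FundamentalGroup T :=
  MonoidHom.mk' (fun a => PresentedGroup.mk _ (hN.graphOfGroups.vGen (v := i) a)) (by
    intro a b
    rw [← map_mul]
    exact ((PresentedGroup.mk_eq_mk_of_mul_inv_mem
    (rels := {r | hN.graphOfGroups.Relator T r})
      (GraphOfGroups.Relator.vertex (𝒢 := hN.graphOfGroups) (T := T) i a b))).symm)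

/-- The stable letters in the fundamental group of the graph of groups. -/
def letter (j : ℰ) (c : Bool) : hN.graphOfGroups.FundamentalGroup T :=
  PresentedGroup.mk _ (hN.graphOfGroups.eGen j c)

theorem letter_mul (j : ℰ) (c : Bool) (a : hN.eSubgroup j) :
    hN.letter j c * hN.vHom (D.origin j c) (hN.edgeIncl j c a) =
      hN.vHom (D.origin j (!c)) (hN.edgeIncl j (!c) a) * hN.letter j c := by
  have := PresentedGroup.mk_eq_mk_of_mul_inv_mem
    (rels := {r | hN.graphOfGroups.Relator T r})
    (GraphOfGroups.Relator.edge (𝒢 := hN.graphOfGroups) (T := T) j c a)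
  rwa [map_mul, map_mul] at this

theorem letter_false (j : ℰ) : hN.letter j false = (hN.letter j true)⁻¹ := by
  have := PresentedGroup.one_of_mem (rels := {r | hN.graphOfGroups.Relator T r})
    (GraphOfGroups.Relator.inverse (𝒢 := hN.graphOfGroups) (T := T) j true)
  rw [map_mul] at this
  exact eq_inv_of_mul_eq_one_right this

theorem letter_tree {j : ℰ} (hj : j ∈ T) (c : Bool) : hN.letter j c = 1 :=
  PresentedGroup.one_of_mem (rels := {r | hN.graphOfGroups.Relator T r})
    (GraphOfGroups.Relator.tree (𝒢 := hN.graphOfGroups) (T := T) j c hj)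

/-- The images of the generators in `G`. -/
def genMap : hN.graphOfGroups.Gen → G
  | Sum.inl ⟨i, a⟩ => (show hN.vSubgroup i from a : G)
  | Sum.inr (j, true) => g j
  | Sum.inr (j, false) => (g j)⁻¹

theorem lift_genMap_vGen (i : 𝒱) (a : hN.vSubgroup i) :
    FreeGroup.lift hN.genMap (hN.graphOfGroups.vGen (v := i) a) = a :=
  FreeGroup.lift_apply_of

theorem lift_genMap_eGen_true (j : ℰ) :
    FreeGroup.lift hN.genMap (hN.graphOfGroups.eGen j true) = g j :=
  FreeGroup.lift_apply_of

theorem lift_genMap_eGen_false (j : ℰ) :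
    FreeGroup.lift hN.genMap (hN.graphOfGroups.eGen j false) = (g j)⁻¹ :=
  FreeGroup.lift_apply_of

/-- The edge relators hold because the inclusion is conjugation by `g j` at the `false` end and
plain inclusion at the `true` end. -/
theorem lift_genMap_relator (r : FreeGroup hN.graphOfGroups.Gen)
    (hr : hN.graphOfGroups.Relator T r) : FreeGroup.lift hN.genMap r = 1 := by
  cases hr with
  | vertex i a b =>
    rw [map_mul, map_mul, map_inv]
    erw [lift_genMap_vGen, lift_genMap_vGen, lift_genMap_vGen]
    rw [mul_inv_eq_one]
    rfl
  | edge j c a =>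
    rw [map_mul, map_inv, map_mul, map_mul]
    cases c
    · erw [lift_genMap_vGen, lift_genMap_vGen, lift_genMap_eGen_false]
      change (g j)⁻¹ * (g j * Subtype.val a * (g j)⁻¹) * (Subtype.val a * (g j)⁻¹)⁻¹
        = 1
      group
    · erw [lift_genMap_vGen, lift_genMap_vGen, lift_genMap_eGen_true]
      change g j * Subtype.val a * ((g j * Subtype.val a * (g j)⁻¹) * g j)⁻¹
        = 1
      group
  | inverse j c =>
    rw [map_mul]
    cases c
    · erw [lift_genMap_eGen_false, lift_genMap_eGen_true]
      simp
    · erw [lift_genMap_eGen_false, lift_genMap_eGen_true]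
      simp
  | tree j c hj =>
    cases c
    · erw [lift_genMap_eGen_false, hN.tree j hj, inv_one]
    · erw [lift_genMap_eGen_true, hN.tree j hj]

/-- The homomorphism from the fundamental group of the graph of groups to `G`. -/
def toGroup : hN.graphOfGroups.FundamentalGroup T →* G :=
  PresentedGroup.toGroup (f := hN.genMap) hN.lift_genMap_relator

theorem toGroup_vHom (i : 𝒱) (a : hN.vSubgroup i) : hN.toGroup (hN.vHom i a) = a :=
  hN.lift_genMap_vGen i a

theorem toGroup_letter (j : ℰ) : hN.toGroup (hN.letter j true) = g j :=
  hN.lift_genMap_eGen_true j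

open Classical in
/-- The values in the fundamental group of the graph of groups of the paths in a vertex space. -/
def localCocycle (i : 𝒱) (γ : C(I, X)) : hN.graphOfGroups.FundamentalGroup T :=
  if h : D.twist g i (γ 0) * L γ * (D.twist g i (γ 1))⁻¹ ∈ hN.vSubgroup i then
    (D.twist (fun j => hN.letter j true) i (γ 0))⁻¹ * hN.vHom i ⟨_, h⟩ *
      D.twist (fun j => hN.letter j true) i (γ 1)
  else 1

theorem localCocycle_of_mem {i : 𝒱} {γ : C(I, X)} (h : ∀ t, γ t ∈ D.vSpace i) :
    hN.localCocycle i γ = (D.twist (fun j => hN.letter j true) i (γ 0))⁻¹ *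
      hN.vHom i ⟨_, hN.twist_mul_mem h⟩ * D.twist (fun j => hN.letter j true) i (γ 1) :=
  dif_pos _

theorem toGroup_localCocycle {i : 𝒱} {γ : C(I, X)} (h : ∀ t, γ t ∈ D.vSpace i) :
    hN.toGroup (hN.localCocycle i γ) = L γ := by
  rw [hN.localCocycle_of_mem h, map_mul, map_mul, map_inv, toGroup_vHom, D.map_twist, D.map_twist]
  simp only [toGroup_letter]
  group

theorem isPathCocycleOn_localCocycle (i : 𝒱) :
    IsPathCocycleOn (D.vSpace i) (hN.localCocycle i) := by
  intro H S hS hH p hp q hq r hr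
  have hmem : ∀ p ∈ S, ∀ q ∈ S, ∀ t, H.comp (affinePath p q) t ∈ D.vSpace i :=
    fun p hp q hq t => hH _ (affinePath_mem hS hp hq t)
  have hm : (⟨_, hN.twist_mul_mem (hmem p hp q hq)⟩ : hN.vSubgroup i) *
      ⟨_, hN.twist_mul_mem (hmem q hq r hr)⟩ = ⟨_, hN.twist_mul_mem (hmem p hp r hr)⟩ := by
    ext
    simp only [ContinuousMap.comp_apply, affinePath_zero, affinePath_one, Subgroup.coe_mul]
    rw [← hN.isPathCocycle H p q r]
    group
  rw [hN.localCocycle_of_mem (hmem p hp q hq), hN.localCocycle_of_mem (hmem q hq r hr),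
    hN.localCocycle_of_mem (hmem p hp r hr), ← hm, map_mul]
  simp only [ContinuousMap.comp_apply, affinePath_zero, affinePath_one]
  group

/-- The twists at the `false` end are the stable letter, so the two sides differ exactly by the edge
relation applied to `L γ`. -/
theorem localCocycle_eSpace {j : ℰ} {γ : C(I, X)} (h : ∀ t, γ t ∈ D.eSpace j) :
    hN.localCocycle (D.origin j true) γ = hN.localCocycle (D.origin j false) γ := by
  rw [hN.localCocycle_of_mem fun t => D.eSpace_subset j true (h t),
    hN.localCocycle_of_mem fun t => D.eSpace_subset j false (h t)]
  have e : hN.letter j true * hN.vHom (D.origin j true)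
        (hN.edgeIncl j true ⟨_, hN.mem_eSubgroup h⟩) =
      hN.vHom (D.origin j false) (hN.edgeIncl j false ⟨_, hN.mem_eSubgroup h⟩) *
        hN.letter j true := hN.letter_mul j true _
  have e1 : hN.edgeIncl j true ⟨_, hN.mem_eSubgroup h⟩ =
      ⟨_, hN.twist_mul_mem fun t => D.eSpace_subset j true (h t)⟩ := by
    ext
    simp [edgeIncl, D.twist_true g (h 0), D.twist_true g (h 1)]
  have e2 : hN.edgeIncl j false ⟨_, hN.mem_eSubgroup h⟩ =
      ⟨_, hN.twist_mul_mem fun t => D.eSpace_subset j false (h t)⟩ := by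
    ext
    simp [edgeIncl, D.twist_false g (h 0), D.twist_false g (h 1)]
  rw [← e1, ← e2, D.twist_true (fun j => hN.letter j true) (h 0),
    D.twist_true (fun j => hN.letter j true) (h 1), D.twist_false (fun j => hN.letter j true) (h 0),
    D.twist_false (fun j => hN.letter j true) (h 1), mul_assoc _ _ (hN.letter j true), ← e]
  group

theorem localCocycle_agree (i i' : 𝒱) (γ : C(I, X)) (h : ∀ t, γ t ∈ D.vSpace i)
    (h' : ∀ t, γ t ∈ D.vSpace i') : hN.localCocycle i γ = hN.localCocycle i' γ := by
  by_cases hne : i = i'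
  · rw [hne]
  obtain ⟨j, hj⟩ := D.exists_eSpace_of_path hne γ h h'
  obtain ⟨c, rfl⟩ := D.exists_origin (hj 0) (h 0)
  obtain ⟨c', rfl⟩ := D.exists_origin (hj 0) (h' 0)
  have := hN.localCocycle_eSpace hj
  cases c <;> cases c'
  exacts [rfl, this.symm, this, rfl]

/-- This is van Kampen's theorem. The local cocycles glue to `N`, which lifts `L` through `toGroup`;
this gives surjectivity. As `L` is universal, `N` induces `ψ` on `G`, and `ψ` is checked on
generators to be a left inverse of `toGroup`. -/
theorem bijective_toGroup (hT : ∀ v w, EdgeJoined D.origin T v w) :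
    Function.Bijective hN.toGroup := by
  obtain ⟨N, hNc, hNl⟩ := exists_isPathCocycle_of_local D.isOpen_vSpace D.cover
    hN.isPathCocycleOn_localCocycle hN.localCocycle_agree
  have hNL : ∀ γ, hN.toGroup (N γ) = L γ := by
    refine IsPathCocycle.eq_of_eq_on_small (fun H p q r => ?_) hN.isPathCocycle D.isOpen_vSpace
      D.cover fun i γ hγ => ?_
    · rw [← map_mul, hNc]
    · rw [hNl i γ hγ, hN.toGroup_localCocycle hγ]
  have hv : ∀ i (q : Path (D.vBase i) (D.vBase i)) (hq : ∀ t, q t ∈ D.vSpace i),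
      N q.toContinuousMap = hN.vHom i ⟨L q.toContinuousMap, q, hq, rfl⟩ := by
    intro i q hq
    rw [hNl i _ hq, hN.localCocycle_of_mem (γ := q.toContinuousMap) hq]
    have hb := D.twist_of_notMem (fun j => hN.letter j true) (D.vBase_notMem i) i
    have hb' := D.twist_of_notMem g (D.vBase_notMem i) i
    simp [hb, hb']
  -- Crossing the edge `j` realizes the inverse of its stable letter for both cocycles at once.
  have he : ∀ j, ∃ p : Path (D.vBase (D.origin j true)) (D.vBase (D.origin j false)),
      L p.toContinuousMap = (g j)⁻¹ ∧ N p.toContinuousMap = (hN.letter j true)⁻¹ := by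
    intro j
    obtain ⟨p, hp, hp1⟩ := hN.path_true j
    obtain ⟨q, hq, hq1⟩ := hN.path_false j
    have hNp : N p.toContinuousMap = 1 := by
      rw [hNl _ _ hp, hN.localCocycle_of_mem (γ := p.toContinuousMap) hp]
      have hb := fun {A : Type u} [Group A] (f : ℰ → A) => D.twist_of_notMem f
        (D.vBase_notMem (D.origin j true)) (D.origin j true)
      have hc := fun {A : Type u} [Group A] (f : ℰ → A) => D.twist_true f (D.eBase_mem j)
      simp [hb, hc, hp1]
      exact map_one (hN.vHom (D.origin j true))
    have hNq : N q.toContinuousMap = hN.letter j true := by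
      rw [hNl _ _ hq, hN.localCocycle_of_mem (γ := q.toContinuousMap) hq]
      have hb := fun {A : Type u} [Group A] (f : ℰ → A) => D.twist_of_notMem f
        (D.vBase_notMem (D.origin j false)) (D.origin j false)
      have hc := fun {A : Type u} [Group A] (f : ℰ → A) => D.twist_false f (D.eBase_mem j)
      simp [hb, hc, hq1]
      exact map_one (hN.vHom (D.origin j false))
    refine ⟨p.trans q.symm, ?_, ?_⟩
    · rw [hN.isPathCocycle.trans, hN.isPathCocycle.symm, hp1, hq1, one_mul]
    · rw [hNc.trans, hNc.symm, hNp, hNq, one_mul]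
  let v₀ : 𝒱 := Classical.arbitrary 𝒱
  -- Along the tree both cocycles are trivial, so all base points can be connected to `v₀` without
  -- changing values.
  have hη : ∀ i, ∃ p : Path (D.vBase v₀) (D.vBase i),
      L p.toContinuousMap = 1 ∧ N p.toContinuousMap = 1 := by
    intro i
    induction hT v₀ i with
    | refl => exact ⟨Path.refl _, hN.isPathCocycle.refl _, hNc.refl _⟩
    | tail _ hstep ih =>
      obtain ⟨j, hj, c, rfl, rfl⟩ := hstep
      obtain ⟨p, hp, hp'⟩ := ih
      obtain ⟨q, hq, hq'⟩ := he j
      rw [hN.tree j hj, inv_one] at hq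
      rw [hN.letter_tree hj, inv_one] at hq'
      cases c
      · exact ⟨p.trans q.symm, by rw [hN.isPathCocycle.trans, hN.isPathCocycle.symm, hp, hq]; simp,
          by rw [hNc.trans, hNc.symm, hp', hq']; simp⟩
      · exact ⟨p.trans q, by rw [hN.isPathCocycle.trans, hp, hq]; simp,
          by rw [hNc.trans, hp', hq']; simp⟩
  choose η hη hη' using hη
  choose P hP using hN.isUniversalCocycle.exists_path (D.vBase v₀) (D.vBase v₀)
  have hPN : ∀ q : Path (D.vBase v₀) (D.vBase v₀),
      N (P (L q.toContinuousMap)).toContinuousMap = N q.toContinuousMap := fun q =>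
    hNc.eq_of_homotopic (hN.isUniversalCocycle.homotopic _ _ (hP _))
  let ψ : G →* hN.graphOfGroups.FundamentalGroup T :=
    MonoidHom.mk' (fun a => N (P a).toContinuousMap) (fun a b => by
      rw [← hNc.trans, ← hPN ((P a).trans (P b)), hN.isPathCocycle.trans, hP, hP])
  have hψ : ∀ i i' (q : Path (D.vBase i) (D.vBase i')),
      ψ (L q.toContinuousMap) = N q.toContinuousMap := by
    intro i i' q
    have h := hPN (((η i).trans q).trans (η i').symm)
    simp only [hN.isPathCocycle.trans, hNc.trans, hN.isPathCocycle.symm, hNc.symm, hη, hη',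
      one_mul, mul_one, inv_one] at h
    exact h
  have hletter : ∀ j, ψ (g j) = hN.letter j true := by
    intro j
    obtain ⟨p, hp, hp'⟩ := he j
    have := hψ _ _ p
    rw [hp, hp', map_inv] at this
    exact inv_injective this
  have hleft : ψ.comp hN.toGroup = MonoidHom.id _ := by
    refine PresentedGroup.ext fun x => ?_
    rcases x with ⟨i, a⟩ | ⟨j, c⟩
    · change ψ (hN.toGroup (hN.vHom i a)) = hN.vHom i a
      rw [toGroup_vHom]
      obtain ⟨_, q, hq, rfl⟩ := a
      rw [← hv i q hq, ← hψ]
    · change ψ (hN.toGroup (hN.letter j c)) = hN.letter j c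
      cases c
      · rw [letter_false, map_inv, map_inv, toGroup_letter, hletter]
      · rw [toGroup_letter, hletter]
  refine ⟨Function.LeftInverse.injective (g := ψ) fun x => DFunLike.congr_fun hleft x, fun a => ?_⟩
  exact ⟨N (P a).toContinuousMap, by rw [hNL, hP]⟩

end Iso
end IsNormalized
end SpaceDecomposition

end

theorem SpaceDecomposition.exists_graphOfGroups {X : Type*} [TopologicalSpace X]
    [PathConnectedSpace X] {𝒱 ℰ : Type} [Finite 𝒱] [Finite ℰ] (D : SpaceDecomposition X 𝒱 ℰ)
    {G : Type u} [Group G] (x₀ : X) (e : FundamentalGroup X x₀ ≃* G) :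
    ∃ 𝒢 : GraphOfGroups.{u},
      (∀ v, ∃ i, Nonempty (𝒢.vGroup v ≃* loopSubgroup (D.vSpace i) (D.vBase_mem i))) ∧
      (∀ e, ∃ j, Nonempty (𝒢.eGroup e ≃* loopSubgroup (D.eSpace j) (D.eBase_mem j))) ∧
      ∃ T : Set 𝒢.Edge, 𝒢.IsMaximalTree T ∧ Nonempty (G ≃* 𝒢.FundamentalGroup T) := by
  have : Nonempty 𝒱 := ⟨(D.cover x₀).choose⟩
  obtain ⟨L₀, hL₀⟩ := exists_isUniversalCocycle x₀ e
  obtain ⟨T, hT, hT'⟩ := exists_maximal_tree D.edgeJoined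
  obtain ⟨L, g, hN⟩ := D.exists_isNormalized hL₀ hT'
  exact ⟨hN.graphOfGroups,
    fun i => ⟨i, nonempty_loopValues_mulEquiv hN.isUniversalCocycle _ (D.vBase_mem i)⟩,
    fun j => ⟨j, nonempty_loopValues_mulEquiv hN.isUniversalCocycle _ (D.eBase_mem j)⟩,
    T, ⟨hT, hT'⟩, ⟨(MulEquiv.ofBijective hN.toGroup (hN.bijective_toGroup hT)).symm⟩⟩

/-! ### Growth -/

section Growth

variable {H H' : Type*} [Group H] [Group H']

theorem wordBall_map (e : H ≃* H') (S : Finset H) (n : ℕ) :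
    wordBall (S.map e.toEquiv.toEmbedding) n = e '' wordBall S n := by
  ext h
  constructor
  · rintro ⟨l, hl, hS, rfl⟩
    refine ⟨(l.map e.symm).prod, ⟨l.map e.symm, by simpa, ?_, rfl⟩, ?_⟩
    · intro a ha
      obtain ⟨b, hb, rfl⟩ := List.mem_map.1 ha
      rcases hS b hb with h | h
      · left
        obtain ⟨c, hc, rfl⟩ := Finset.mem_map.1 h
        simpa using hc
      · right
        obtain ⟨c, hc, h⟩ := Finset.mem_map.1 h
        rw [← map_inv, ← h]
        simpa using hc
    · rw [map_list_prod, List.map_map]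
      congr 1
      simp
  · rintro ⟨_, ⟨l, hl, hS, rfl⟩, rfl⟩
    refine ⟨l.map e, by simpa, fun a ha => ?_, (map_list_prod e l).symm⟩
    obtain ⟨b, hb, rfl⟩ := List.mem_map.1 ha
    rcases hS b hb with h | h
    · exact Or.inl (Finset.mem_map.2 ⟨b, h, rfl⟩)
    · exact Or.inr (Finset.mem_map.2 ⟨b⁻¹, h, map_inv e b⟩)

theorem growthFunction_map (e : H ≃* H') (S : Finset H) (n : ℕ) :
    growthFunction (S.map e.toEquiv.toEmbedding) n = growthFunction S n := by
  rw [growthFunction, wordBall_map]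
  exact Set.ncard_image_of_injective _ e.injective

theorem HasSubexponentialGrowth.of_mulEquiv (e : H ≃* H') (h : HasSubexponentialGrowth H) :
    HasSubexponentialGrowth H' := by
  refine ⟨@Group.fg_of_surjective _ _ _ _ h.1 e.toMonoidHom e.surjective, fun S hS => ?_⟩
  have := h.2 (S.map e.symm.toEquiv.toEmbedding) (by
    rw [Finset.coe_map]
    change Subgroup.closure (e.symm.toMonoidHom '' S) = ⊤
    rw [← MonoidHom.map_closure, hS]
    exact Subgroup.map_top_of_surjective _ e.symm.surjective)
  simpa only [growthFunction_map] using this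

/-- The double logarithm can be negative only when the ball has two elements, so it is bounded below
by a constant, and dividing by `log n` makes this bound vanish in the limit. -/
theorem subexponentialGrowthRate_nonneg : 0 ≤ subexponentialGrowthRate H := by
  refine le_iInf₂ fun S _ => ?_
  have hlim : Tendsto (fun n : ℕ => min 0 (Real.log (Real.log 2)) / Real.log n) atTop (𝓝 0) :=
    tendsto_const_nhds.div_atTop (Real.tendsto_log_atTop.comp tendsto_natCast_atTop_atTop)
  have hlim' : Tendsto (fun n : ℕ => ((min 0 (Real.log (Real.log 2)) / Real.log n : ℝ) : EReal))
      atTop (𝓝 ((0 : ℝ) : EReal)) := (continuous_coe_real_ereal.tendsto 0).comp hlim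
  rw [EReal.coe_zero] at hlim'
  rw [← hlim'.limsup_eq]
  refine limsup_le_limsup (Eventually.of_forall fun n => ?_)
  refine EReal.coe_le_coe_iff.2 ?_
  have h0 : 0 ≤ Real.log n := Real.log_natCast_nonneg n
  refine div_le_div_of_nonneg_right ?_ h0
  rcases lt_or_ge (growthFunction S n) 2 with h | h
  -- With fewer than two elements the inner logarithm is `0`, and the outer one is `0` by the
  -- convention `Real.log 0 = 0`.
  · have : Real.log (growthFunction S n) = 0 := by interval_cases growthFunction S n <;> simp
    rw [this, Real.log_zero]
    exact min_le_left _ _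
  · refine (min_le_right _ _).trans (Real.log_le_log (Real.log_pos one_lt_two) ?_)
    exact Real.log_le_log two_pos (by exact_mod_cast h)

end Growth

/-! ### Simplicial maps -/

section Simplicial

open Classical
open scoped unitInterval

variable {V : Type*} [Fintype V] {W : Type*} {K : AbstractSimplicialComplex V}
  {P : AbstractSimplicialComplex W} {f : V → W}

theorem mem_coordSupport {x : stdSimplex ℝ V} {u : V} : u ∈ coordSupport x ↔ x u ≠ 0 := by
  simp [coordSupport]

theorem coordSupport_nonempty (x : stdSimplex ℝ V) : (coordSupport x).Nonempty := by
  by_contra h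
  rw [Finset.not_nonempty_iff_eq_empty] at h
  have : ∀ u, x u = 0 := fun u => by
    by_contra hu
    exact absurd (mem_coordSupport.2 hu) (by simp [h])
  have h1 := stdSimplex.sum_eq_one x
  simp [this] at h1

theorem mem_faces_of_subset {V : Type*} {K : AbstractSimplicialComplex V} {s t : Finset V} (hs : s ∈ K.faces)
    (hts : t ⊆ s) (ht : t.Nonempty) : t ∈ K.faces :=
  (K.isRelLowerSet_faces hs).2 hts ht

/-- The point at time `t` on the line segment from `x` to `y`. -/
def blend (x y : stdSimplex ℝ V) (t : I) : stdSimplex ℝ V :=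
  ⟨fun u => (1 - t : ℝ) * x u + t * y u,
    convex_stdSimplex ℝ V x.2 y.2 (sub_nonneg.2 t.2.2) t.2.1 (by ring)⟩

theorem blend_apply (x y : stdSimplex ℝ V) (t : I) (u : V) :
    blend x y t u = (1 - t : ℝ) * x u + t * y u := rfl

theorem coordSupport_blend_subset {x y : stdSimplex ℝ V} (h : coordSupport y ⊆ coordSupport x)
    (t : I) : coordSupport (blend x y t) ⊆ coordSupport x := by
  intro u hu
  by_contra hx
  have hy : u ∉ coordSupport y := fun h' => hx (h h')
  rw [mem_coordSupport, not_not] at hx hy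
  rw [mem_coordSupport, blend_apply, hx, hy] at hu
  simp at hu

theorem subset_coordSupport_blend {x y : stdSimplex ℝ V} (h : coordSupport y ⊆ coordSupport x)
    (t : I) : coordSupport y ⊆ coordSupport (blend x y t) := by
  intro u hu
  have hx := h hu
  rw [mem_coordSupport] at hx hu ⊢
  rw [blend_apply]
  have hx' := lt_of_le_of_ne (stdSimplex.zero_le x u) hx.symm
  have hu' := lt_of_le_of_ne (stdSimplex.zero_le y u) hu.symm
  have h0 := t.2.1
  have h1 := t.2.2
  rcases h0.eq_or_lt with h | h
  · rw [← h]; simpa using hx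
  · have : 0 ≤ (1 - t : ℝ) * x u := mul_nonneg (by linarith) hx'.le
    have : 0 < (t : ℝ) * y u := mul_pos h hu'
    linarith

/-- The line segment in the realization between points with nested supports. -/
def blendIn (x y : realization K) (h : coordSupport y.1 ⊆ coordSupport x.1) (t : I) :
    realization K :=
  ⟨blend x.1 y.1 t, mem_faces_of_subset x.2 (coordSupport_blend_subset h t)
    (coordSupport_nonempty _)⟩

theorem continuous_coord (u : V) : Continuous fun x : realization K => x.1 u :=
  (continuous_apply u).comp (continuous_subtype_val.comp continuous_subtype_val)

theorem continuous_realization_mk {Y : Type*} [TopologicalSpace Y] {φ : Y → realization K}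
    (h : ∀ u, Continuous fun y => (φ y).1 u) : Continuous φ := by
  refine Continuous.subtype_mk (f := fun y => (φ y).1) (Continuous.subtype_mk
    (f := fun y u => (φ y).1 u) (continuous_pi h) fun y => (φ y).1.2) fun y => (φ y).2

theorem realization_ext {x y : realization K} (h : ∀ u, x.1 u = y.1 u) : x = y :=
  Subtype.ext (stdSimplex.ext (funext h))

theorem continuous_blendIn {Y : Type*} [TopologicalSpace Y] {a b : Y → realization K}
    {τ : Y → I} (ha : Continuous a) (hb : Continuous b) (hτ : Continuous τ)
    (h : ∀ y, coordSupport (b y).1 ⊆ coordSupport (a y).1) :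
    Continuous fun y => blendIn (a y) (b y) (h y) (τ y) := by
  refine continuous_realization_mk fun u => ?_
  change Continuous fun y => (1 - τ y : ℝ) * (a y).1 u + τ y * (b y).1 u
  have h1 := (continuous_coord (K := K) u).comp ha
  have h2 := (continuous_coord (K := K) u).comp hb
  have h3 : Continuous fun y => (τ y : ℝ) := continuous_subtype_val.comp hτ
  exact ((continuous_const.sub h3).mul h1).add (h3.mul h2)

theorem blendIn_zero (x y : realization K) (h : coordSupport y.1 ⊆ coordSupport x.1) :
    blendIn x y h 0 = x := realization_ext fun u => by simp [blendIn, blend_apply]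

theorem blendIn_one (x y : realization K) (h : coordSupport y.1 ⊆ coordSupport x.1) :
    blendIn x y h 1 = y := realization_ext fun u => by simp [blendIn, blend_apply]

theorem blendIn_self (x : realization K) (t : I) : blendIn x x subset_rfl t = x :=
  realization_ext fun u => by simp only [blendIn, blend_apply]; ring

variable (K f) in
/-- The preimage of the open star of the simplex `s`. -/
def starPreimage (s : Finset W) : Set (realization K) := {x | s ⊆ (coordSupport x.1).image f}

theorem starPreimage_of_subset {s : Finset W} {x y : realization K} (hx : x ∈ starPreimage K f s)
    (h : coordSupport x.1 ⊆ coordSupport y.1) : y ∈ starPreimage K f s :=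
  Finset.Subset.trans hx (Finset.image_subset_image h)

theorem starPreimage_mono {s s' : Finset W} (h : s ⊆ s') :
    starPreimage K f s' ⊆ starPreimage K f s := fun _ hx => h.trans hx

/-- On the segment from `x` to `y` the support always contains that of `y`, and enlarging the
support does not leave the star preimage. -/
theorem joinedIn_starPreimage {s : Finset W} {x y : realization K} (hy : y ∈ starPreimage K f s)
    (h : coordSupport y.1 ⊆ coordSupport x.1) : JoinedIn (starPreimage K f s) x y :=
  ⟨⟨⟨fun t => blendIn x y h t, continuous_blendIn continuous_const continuous_const continuous_id
      fun _ => h⟩, blendIn_zero x y h, blendIn_one x y h⟩,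
    fun t => starPreimage_of_subset hy (subset_coordSupport_blend h t)⟩

theorem isOpen_setOf_subset_coordSupport (c : Finset V) :
    IsOpen {x : realization K | c ⊆ coordSupport x.1} := by
  have : {x : realization K | c ⊆ coordSupport x.1} = ⋂ u ∈ c, {x | x.1 u ≠ 0} := by
    ext x
    simp [Finset.subset_iff, mem_coordSupport]
  rw [this]
  exact isOpen_biInter_finset fun u _ => isOpen_ne_fun (continuous_coord u) continuous_const

/-- The points whose support contains that of `y` form a neighbourhood of `y`, and each is joined to
`y` by a segment. -/
theorem isOpen_pathComponentIn_starPreimage (s : Finset W) (x : realization K) :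
    IsOpen (pathComponentIn (starPreimage K f s) x) := by
  rw [isOpen_iff_mem_nhds]
  intro y hy
  filter_upwards [(isOpen_setOf_subset_coordSupport (coordSupport y.1)).mem_nhds
    (Finset.Subset.refl (coordSupport y.1))] with z hz
  exact JoinedIn.trans hy (joinedIn_starPreimage (pathComponentIn_subset hy) hz).symm

variable (K f) in
/-- The path components of the preimage of an open star. -/
def starComponents (s : Finset W) : Set (Set (realization K)) :=
  {S | ∃ x ∈ starPreimage K f s, S = pathComponentIn (starPreimage K f s) x}

/-- Points with the same support lie in the same component, and there are finitely many supports. -/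
theorem finite_starComponents (s : Finset W) : (starComponents K f s).Finite := by
  let F : Finset V → Set (realization K) := fun c =>
    if h : ∃ x ∈ starPreimage K f s, coordSupport x.1 = c then
      pathComponentIn (starPreimage K f s) h.choose else ∅
  refine (Set.finite_range F).subset ?_
  rintro _ ⟨x, hx, rfl⟩
  have h : ∃ y ∈ starPreimage K f s, coordSupport y.1 = coordSupport x.1 := ⟨x, hx, rfl⟩
  refine ⟨coordSupport x.1, ?_⟩
  simp only [F, dif_pos h]
  exact pathComponentIn_congr (joinedIn_starPreimage h.choose_spec.1 h.choose_spec.2.le)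

/-! ### Retraction to the fiber over the barycenter -/

variable [Fintype W]

theorem map_apply_eq_sum (x : stdSimplex ℝ V) (w : W) :
    stdSimplex.map f x w = ∑ u with f u = w, x u := by
  simp [stdSimplex.map_coe, FunOnFinite.linearMap_apply_apply]

theorem map_pos {s : Finset W} {x : realization K} (hx : x ∈ starPreimage K f s) {w : W}
    (hw : w ∈ s) : 0 < stdSimplex.map f x.1 w := by
  have h := hx hw
  rw [← coordSupport_map, mem_coordSupport] at h
  exact lt_of_le_of_ne (stdSimplex.zero_le _ w) h.symm

/-- The coordinates of the retraction of the preimage of the open star of `s` to the fiber over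
the barycenter of `s`. -/
def retractCoord (f : V → W) (s : Finset W) (x : stdSimplex ℝ V) (u : V) : ℝ :=
  if f u ∈ s then x u / (s.card * stdSimplex.map f x (f u)) else 0

/-- Over each vertex of `s` the weights are rescaled to the same total; the star condition keeps the
denominators positive. -/
theorem sum_fiber_retractCoord {s : Finset W} {x : realization K}
    (hx : x ∈ starPreimage K f s) (w : W) :
    ∑ u with f u = w, retractCoord f s x.1 u = if w ∈ s then (s.card : ℝ)⁻¹ else 0 := by
  have h : ∀ u ∈ Finset.univ.filter (fun u => f u = w), retractCoord f s x.1 u =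
      if w ∈ s then x.1 u / (s.card * stdSimplex.map f x.1 w) else 0 := by
    intro u hu
    rw [Finset.mem_filter] at hu
    rw [retractCoord, hu.2]
  rw [Finset.sum_congr rfl h]
  split_ifs with hw
  · rw [← Finset.sum_div, ← map_apply_eq_sum]
    have h1 := (map_pos hx hw).ne'
    have h2 : (s.card : ℝ) ≠ 0 := by
      exact_mod_cast (Finset.card_pos.2 ⟨w, hw⟩).ne'
    field_simp
  · simp

theorem retractCoord_mem {s : Finset W} (hs : s.Nonempty) {x : realization K}
    (hx : x ∈ starPreimage K f s) : retractCoord f s x.1 ∈ stdSimplex ℝ V := by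
  refine ⟨fun u => ?_, ?_⟩
  · rw [retractCoord]
    split_ifs
    · exact div_nonneg (stdSimplex.zero_le _ _)
        (mul_nonneg (Nat.cast_nonneg _) (stdSimplex.zero_le _ _))
    · rfl
  · rw [← Finset.sum_fiberwise (s := Finset.univ) (g := f)]
    simp_rw [sum_fiber_retractCoord hx]
    rw [Finset.sum_ite_mem, Finset.univ_inter, Finset.sum_const, nsmul_eq_mul]
    exact mul_inv_cancel₀ (by exact_mod_cast (Finset.card_pos.2 hs).ne')

theorem coordSupport_retract_subset {s : Finset W} (hs : s.Nonempty) {x : realization K}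
    (hx : x ∈ starPreimage K f s) :
    coordSupport (⟨_, retractCoord_mem hs hx⟩ : stdSimplex ℝ V) ⊆ coordSupport x.1 := by
  intro u hu
  rw [mem_coordSupport] at hu ⊢
  intro h
  refine hu ?_
  change retractCoord f s x.1 u = 0
  simp [retractCoord, h]

/-- The retraction of the preimage of the open star of `s` to the fiber over the barycenter. -/
def retract {s : Finset W} (hs : s.Nonempty) (x : realization K) (hx : x ∈ starPreimage K f s) :
    realization K :=
  ⟨⟨_, retractCoord_mem hs hx⟩, mem_faces_of_subset x.2 (coordSupport_retract_subset hs hx)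
    (coordSupport_nonempty _)⟩

variable (f) in
/-- The image of `x` is the barycenter of `s`. -/
def MapsToBarycenter (s : Finset W) (x : realization K) : Prop :=
  ∀ w, stdSimplex.map f x.1 w = if w ∈ s then (s.card : ℝ)⁻¹ else 0

theorem mapsToBarycenter_retract {s : Finset W} (hs : s.Nonempty) (x : realization K)
    (hx : x ∈ starPreimage K f s) : MapsToBarycenter f s (retract hs x hx) := fun w =>
  (map_apply_eq_sum _ _).trans (sum_fiber_retractCoord hx w)

theorem MapsToBarycenter.mem {s : Finset W} {x : realization K} (h : MapsToBarycenter f s x) :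
    x ∈ starPreimage K f s := by
  intro w hw
  rw [← coordSupport_map, mem_coordSupport, h w, if_pos hw]
  exact inv_ne_zero (by exact_mod_cast (Finset.card_pos.2 ⟨w, hw⟩).ne')

/-- Separates the pieces: a point over the barycenter of `s` lies only in star preimages of faces of
`s`. -/
theorem MapsToBarycenter.subset {s s' : Finset W} {x : realization K}
    (h : MapsToBarycenter f s x) (hx : x ∈ starPreimage K f s') : s' ⊆ s := by
  intro w hw
  by_contra hws
  have := map_pos hx hw
  rw [h w, if_neg hws] at this
  exact lt_irrefl _ this

theorem MapsToBarycenter.realizationMap_eq (hf : IsSimplicialMap K P f) {s : Finset W}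
    {x y : realization K} (hx : MapsToBarycenter f s x) (hy : MapsToBarycenter f s y) :
    realizationMap hf x = realizationMap hf y :=
  realization_ext fun w => (hx w).trans (hy w).symm

theorem MapsToBarycenter.retract_eq {s : Finset W} (hs : s.Nonempty) {x : realization K}
    (h : MapsToBarycenter f s x) : retract hs x h.mem = x := by
  refine realization_ext fun u => ?_
  change retractCoord f s x.1 u = x.1 u
  rw [retractCoord, h (f u)]
  split_ifs with hu
  · have h2 : (s.card : ℝ) ≠ 0 := by
      exact_mod_cast (Finset.card_pos.2 ⟨_, hu⟩).ne'
    rw [mul_inv_cancel₀ h2, div_one]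
  · have h0 := h (f u)
    rw [if_neg hu, map_apply_eq_sum,
      Finset.sum_eq_zero_iff_of_nonneg fun v _ => stdSimplex.zero_le _ v] at h0
    exact (h0 u (by simp)).symm

theorem joinedIn_retract {s : Finset W} (hs : s.Nonempty) (x : realization K)
    (hx : x ∈ starPreimage K f s) : JoinedIn (starPreimage K f s) x (retract hs x hx) :=
  joinedIn_starPreimage (mapsToBarycenter_retract hs x hx).mem (coordSupport_retract_subset hs hx)

theorem continuous_map_coord (w : W) :
    Continuous fun x : realization K => stdSimplex.map f x.1 w :=
  (continuous_apply w).comp (continuous_subtype_val.comp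
    ((stdSimplex.continuous_map f).comp continuous_subtype_val))

theorem continuous_retract {s : Finset W} (hs : s.Nonempty) {Y : Type*} [TopologicalSpace Y]
    {a : Y → realization K} (ha : Continuous a) (h : ∀ y, a y ∈ starPreimage K f s) :
    Continuous fun y => retract hs (a y) (h y) := by
  refine continuous_realization_mk fun u => ?_
  change Continuous fun y => retractCoord f s (a y).1 u
  unfold retractCoord
  split_ifs with hu
  · refine ((continuous_coord u).comp ha).div
      (continuous_const.mul ((continuous_map_coord (f u)).comp ha)) fun y => ?_
    refine mul_ne_zero ?_ (map_pos (h y) hu).ne'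
    exact_mod_cast (Finset.card_pos.2 ⟨_, hu⟩).ne'
  · exact continuous_const

/-- The retraction only shrinks supports, so the straight-line homotopy stays in the complex; it
fixes `b`, which already lies over the barycenter. -/
theorem exists_homotopic_loop_in_fiber {s : Finset W} (hs : s.Nonempty) {b : realization K}
    (hb : MapsToBarycenter f s b) (γ : Path b b) (hγ : ∀ t, γ t ∈ starPreimage K f s) :
    ∃ γ' : Path b b, (∀ t, MapsToBarycenter f s (γ' t)) ∧ γ.Homotopic γ' := by
  have hb0 : ∀ {t}, γ t = b → retract hs (γ t) (hγ t) = b := fun {t} h => by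
    have := hb.retract_eq hs
    simp only [h, this]
  let γ' : Path b b := ⟨⟨fun t => retract hs (γ t) (hγ t), continuous_retract hs γ.continuous hγ⟩,
    hb0 γ.source, hb0 γ.target⟩
  refine ⟨γ', fun t => mapsToBarycenter_retract hs _ (hγ t), ⟨?_⟩⟩
  have hsupp : ∀ t, coordSupport (γ' t).1 ⊆ coordSupport (γ t).1 :=
    fun t => coordSupport_retract_subset hs (hγ t)
  exact
    { toFun := fun z => blendIn (γ z.2) (γ' z.2) (hsupp z.2) z.1
      continuous_toFun := continuous_blendIn (γ.continuous.comp continuous_snd)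
        (γ'.continuous.comp continuous_snd) continuous_fst fun z => hsupp z.2
      map_zero_left := fun t => blendIn_zero _ _ _
      map_one_left := fun t => blendIn_one _ _ _
      prop' := by
        intro z t ht
        have h : γ' t = γ t := by
          rcases ht with rfl | ht
          · rw [γ.source, γ'.source]
          · rw [Set.mem_singleton_iff.1 ht, γ.target, γ'.target]
        change blendIn (γ t) (γ' t) (hsupp t) z = γ t
        simp only [h, blendIn_self] }

/-- A loop in the piece is retracted into the fiber, where connectedness keeps it in the component
of `b`. Conversely a loop in the fiber lies in the star preimage, and its path connected image stays
in the path component. -/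
theorem loopSubgroup_eq_inducedSubgroup (hf : IsSimplicialMap K P f) {s : Finset W}
    (hs : s.Nonempty) {x b : realization K} (hb : MapsToBarycenter f s b)
    (hbx : b ∈ pathComponentIn (starPreimage K f s) x) :
    loopSubgroup (pathComponentIn (starPreimage K f s) x) hbx =
      inducedSubgroup (realizationMap hf ⁻¹' {realizationMap hf b}) rfl := by
  ext c
  constructor
  · rintro ⟨γ, hγ, rfl⟩
    obtain ⟨γ', hγ', hom⟩ := exists_homotopic_loop_in_fiber hs hb γ
      fun t => pathComponentIn_subset (hγ t)
    have hsub : ∀ t, γ' t ∈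
        connectedComponentIn (realizationMap hf ⁻¹' {realizationMap hf b}) b := fun t =>
      (isPreconnected_range γ'.continuous).subset_connectedComponentIn ⟨0, γ'.source⟩
        (by
          rintro _ ⟨t, rfl⟩
          exact (hγ' t).realizationMap_eq hf hb) ⟨t, rfl⟩
    let δ : Path (⟨b, mem_connectedComponentIn rfl⟩ :
        connectedComponentIn (realizationMap hf ⁻¹' {realizationMap hf b}) b)
        ⟨b, mem_connectedComponentIn rfl⟩ :=
      ⟨⟨fun t => ⟨γ' t, hsub t⟩, γ'.continuous.subtype_mk _⟩, Subtype.ext γ'.source,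
        Subtype.ext γ'.target⟩
    refine ⟨FundamentalGroup.fromPath (Path.Homotopic.Quotient.mk δ), ?_⟩
    exact (Path.Homotopic.Quotient.eq.2 hom).symm
  · rintro ⟨d, rfl⟩
    obtain ⟨δ, rfl⟩ := Path.Homotopic.Quotient.mk_surjective d
    refine ⟨δ.map continuous_subtype_val, fun t => ?_, rfl⟩
    have hstar : ∀ t, (δ t : realization K) ∈ starPreimage K f s := fun t => by
      have h1 : realizationMap hf (δ t) = realizationMap hf b :=
        connectedComponentIn_subset (realizationMap hf ⁻¹' {realizationMap hf b}) b (δ t).2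
      refine MapsToBarycenter.mem fun w => ?_
      rw [← hb w]
      exact DFunLike.congr_fun (congrArg Subtype.val h1) w
    refine JoinedIn.trans hbx ?_
    have : PathConnectedSpace I :=
      isPathConnected_iff_pathConnectedSpace.1 ((convex_Icc (0 : ℝ) 1).isPathConnected ⟨0, by simp⟩)
    have hpc : IsPathConnected (Set.range (δ.map continuous_subtype_val)) :=
      isPathConnected_range (δ.map continuous_subtype_val).continuous
    exact hpc.subset_pathComponentIn ⟨0, (δ.map continuous_subtype_val).source⟩
      (by rintro _ ⟨t, rfl⟩; exact hstar t) ⟨t, rfl⟩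

end Simplicial

/-! ### The decomposition induced by a map to a graph -/

section SimplicialDecomposition

open Classical

variable {V : Type*} [Fintype V] {W : Type*} {K : AbstractSimplicialComplex V}
  {P : AbstractSimplicialComplex W} {f : V → W}

theorem pathComponentIn_starPreimage_eq {s : Finset W} {x y : realization K}
    (h : y ∈ pathComponentIn (starPreimage K f s) x) :
    pathComponentIn (starPreimage K f s) x = pathComponentIn (starPreimage K f s) y :=
  (pathComponentIn_congr h).symm

/-- No simplex of a graph properly contains an edge. Here the dimension bound on `P` enters: it
prevents triple overlaps of vertex pieces. -/
theorem eq_image_of_mem_starPreimage (hf : IsSimplicialMap K P f)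
    (hP : ∀ s ∈ P.faces, s.card ≤ 2) {w w' : W} (hw : w ≠ w') {x : realization K}
    (hx : x ∈ starPreimage K f {w, w'}) : {w, w'} = (coordSupport x.1).image f :=
  Finset.eq_of_subset_of_card_le hx (by
    rw [Finset.card_pair hw]
    exact hP _ (hf _ x.2))

/-- A simplicial map to a graph decomposes its domain into the preimages of the open stars of the
vertices, which meet in the preimages of the open edges. -/
theorem exists_spaceDecomposition [Fintype W] (hf : IsSimplicialMap K P f)
    (hP : ∀ s ∈ P.faces, s.card ≤ 2) :
    ∃ (n m : ℕ) (D : SpaceDecomposition (realization K) (Fin n) (Fin m)),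
      (∀ i, loopSubgroup (D.vSpace i) (D.vBase_mem i) =
        inducedSubgroup (realizationMap hf ⁻¹' {realizationMap hf (D.vBase i)}) rfl) ∧
      ∀ j, loopSubgroup (D.eSpace j) (D.eBase_mem j) =
        inducedSubgroup (realizationMap hf ⁻¹' {realizationMap hf (D.eBase j)}) rfl := by
  -- Pieces are indexed injectively as sets, so an edge piece arising from both orders of its end
  -- vertices is counted once.
  obtain ⟨n, vS, hvS⟩ := (Set.finite_iUnion fun w : W =>
    finite_starComponents (K := K) (f := f) {w}).fin_embedding
  obtain ⟨m, eS, heS⟩ := (Set.finite_iUnion fun z : {z : W × W // z.1 ≠ z.2} =>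
    finite_starComponents (K := K) (f := f) {z.1.1, z.1.2}).fin_embedding
  have hv : ∀ i, ∃ w, ∃ x ∈ starPreimage K f {w},
      vS i = pathComponentIn (starPreimage K f {w}) x := fun i =>
    Set.mem_iUnion.1 (hvS ▸ Set.mem_range_self i)
  have hv' : ∀ w, ∀ x ∈ starPreimage K f {w}, ∃ i,
      vS i = pathComponentIn (starPreimage K f {w}) x := fun w x hx => by
    have : pathComponentIn (starPreimage K f {w}) x ∈ Set.range vS :=
      hvS ▸ Set.mem_iUnion.2 ⟨w, x, hx, rfl⟩
    exact this
  have he : ∀ j, ∃ w w', w ≠ w' ∧ ∃ x ∈ starPreimage K f {w, w'},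
      eS j = pathComponentIn (starPreimage K f {w, w'}) x := fun j => by
    obtain ⟨z, h⟩ := Set.mem_iUnion.1 (heS ▸ Set.mem_range_self j)
    exact ⟨_, _, z.2, h⟩
  have he' : ∀ w w', w ≠ w' → ∀ x ∈ starPreimage K f {w, w'}, ∃ j,
      eS j = pathComponentIn (starPreimage K f {w, w'}) x := fun w w' hw x hx => by
    have : pathComponentIn (starPreimage K f {w, w'}) x ∈ Set.range eS :=
      heS ▸ Set.mem_iUnion.2 ⟨⟨(w, w'), hw⟩, x, hx, rfl⟩
    exact this
  choose vw vx hvx hvS using hv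
  choose ew ew' hew ex hex heS using he
  have hpair : ∀ j (c : Bool), ({bif c then ew j else ew' j} : Finset W) ⊆ {ew j, ew' j} := by
    intro j c
    cases c <;> simp
  -- The ends of an edge piece are the components, in the stars of its two vertices, that contain
  -- it.
  have ho : ∀ j (c : Bool), ∃ i, vS i =
      pathComponentIn (starPreimage K f {bif c then ew j else ew' j}) (ex j) := fun j c =>
    hv' _ _ (starPreimage_mono (hpair j c) (hex j))
  choose o ho using ho
  have hvmem : ∀ {i x}, x ∈ vS i → x ∈ starPreimage K f {vw i} ∧
      vS i = pathComponentIn (starPreimage K f {vw i}) x := fun {i x} hx => by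
    rw [hvS] at hx
    exact ⟨pathComponentIn_subset hx, (hvS i).trans (pathComponentIn_starPreimage_eq hx)⟩
  have hemem : ∀ {j x}, x ∈ eS j → x ∈ starPreimage K f {ew j, ew' j} ∧
      eS j = pathComponentIn (starPreimage K f {ew j, ew' j}) x := fun {j x} hx => by
    rw [heS] at hx
    exact ⟨pathComponentIn_subset hx, (heS j).trans (pathComponentIn_starPreimage_eq hx)⟩
  have hsub : ∀ j c, eS j ⊆ vS (o j c) := fun j c => by
    rw [heS, ho]
    exact pathComponentIn_mono (starPreimage_mono (hpair j c))
  have hvb : ∀ i, MapsToBarycenter f {vw i} (retract (Finset.singleton_nonempty _) (vx i) (hvx i)) :=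
    fun i => mapsToBarycenter_retract _ _ _
  have hvbm : ∀ i, retract (Finset.singleton_nonempty _) (vx i) (hvx i) ∈ vS i := fun i => by
    rw [hvS]
    exact joinedIn_retract _ _ _
  have heb : ∀ j, MapsToBarycenter f {ew j, ew' j}
      (retract (Finset.insert_nonempty _ _) (ex j) (hex j)) :=
    fun j => mapsToBarycenter_retract _ _ _
  have hebm : ∀ j, retract (Finset.insert_nonempty _ _) (ex j) (hex j) ∈ eS j := fun j => by
    rw [heS]
    exact joinedIn_retract _ _ _
  let D : SpaceDecomposition (realization K) (Fin n) (Fin m) :=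
    { origin := o
      vSpace := vS
      eSpace := eS
      isOpen_vSpace := fun i => by rw [hvS]; exact isOpen_pathComponentIn_starPreimage _ _
      isOpen_eSpace := fun j => by rw [heS]; exact isOpen_pathComponentIn_starPreimage _ _
      isPathConnected_vSpace := fun i => by
        rw [hvS]; exact isPathConnected_pathComponentIn (hvx i)
      isPathConnected_eSpace := fun j => by
        rw [heS]; exact isPathConnected_pathComponentIn (hex j)
      cover := fun x => by
        obtain ⟨u, hu⟩ := coordSupport_nonempty x.1
        have hx : x ∈ starPreimage K f {f u} :=
          Finset.singleton_subset_iff.2 (Finset.mem_image_of_mem f hu)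
        obtain ⟨i, hi⟩ := hv' (f u) x hx
        exact ⟨i, hi ▸ mem_pathComponentIn_self hx⟩
      eSpace_subset := hsub
      -- Retracting a point of the edge piece to the vertex `ew j` stays in the first end; were the
      -- ends equal, that point would also lie in the star preimage of `ew' j`.
      origin_ne := fun j h => by
        have hx := starPreimage_mono (hpair j true) (hex j)
        have hmem : retract (Finset.singleton_nonempty _) (ex j) hx ∈ vS (o j true) := by
          rw [ho]
          exact joinedIn_retract _ _ _
        rw [h, ho] at hmem
        have := (mapsToBarycenter_retract (Finset.singleton_nonempty _) (ex j) hx).subset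
          (pathComponentIn_subset hmem)
        simp only [cond_true, cond_false, Finset.singleton_subset_iff,
          Finset.mem_singleton] at this
        exact hew j this.symm
      eSpace_disjoint := fun {j j' x} hj hj' => by
        obtain ⟨h1, h2⟩ := hemem hj
        obtain ⟨h1', h2'⟩ := hemem hj'
        refine eS.injective ?_
        rw [h2, h2', eq_image_of_mem_starPreimage hf hP (hew j) h1,
          eq_image_of_mem_starPreimage hf hP (hew j') h1']
      exists_eSpace := fun {i i' x} hi hi' hne => by
        obtain ⟨h1, h2⟩ := hvmem hi
        obtain ⟨h1', h2'⟩ := hvmem hi'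
        have hw : vw i ≠ vw i' := fun h => hne (vS.injective (by rw [h2, h2', h]))
        have hx : x ∈ starPreimage K f {vw i, vw i'} := Finset.insert_subset
          (Finset.singleton_subset_iff.1 h1) h1'
        obtain ⟨j, hj⟩ := he' _ _ hw x hx
        exact ⟨j, hj ▸ mem_pathComponentIn_self hx⟩
      exists_origin := fun {j i x} hj hi => by
        obtain ⟨h1, h2⟩ := hvmem hi
        obtain ⟨h3, -⟩ := hemem hj
        have hw : vw i ∈ ({ew j, ew' j} : Finset W) := by
          rw [eq_image_of_mem_starPreimage hf hP (hew j) h3]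
          exact Finset.singleton_subset_iff.1 h1
        -- Two components of the same vertex star that share `x` coincide.
        have key : ∀ c, vw i = (bif c then ew j else ew' j) → o j c = i := fun c hc => by
          refine vS.injective ?_
          have := hsub j c hj
          rw [ho] at this
          rw [ho, pathComponentIn_starPreimage_eq this, ← hc, h2]
        rcases Finset.mem_insert.1 hw with h | h
        · exact ⟨true, key true h⟩
        · exact ⟨false, key false (Finset.mem_singleton.1 h)⟩
      vBase := fun i => retract (Finset.singleton_nonempty _) (vx i) (hvx i)
      vBase_mem := hvbm
      vBase_notMem := fun i j hj => by
        have := (hvb i).subset (hemem hj).1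
        have h1 := Finset.mem_singleton.1 (this (Finset.mem_insert_self _ _))
        have h2 := Finset.mem_singleton.1
          (this (Finset.mem_insert_of_mem (Finset.mem_singleton_self _)))
        exact hew j (h1.trans h2.symm)
      eBase := fun j => retract (Finset.insert_nonempty _ _) (ex j) (hex j)
      eBase_mem := hebm }
  have key : ∀ {s : Finset W} (_ : s.Nonempty) {b : realization K} {S : Set (realization K)}
      {x : realization K} (_ : MapsToBarycenter f s b) (hbS : b ∈ S)
      (_ : S = pathComponentIn (starPreimage K f s) x),
      loopSubgroup S hbS = inducedSubgroup (realizationMap hf ⁻¹' {realizationMap hf b}) rfl := by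
    rintro s hs b S x hb hbS rfl
    exact loopSubgroup_eq_inducedSubgroup hf hs hb hbS
  exact ⟨n, m, D, fun i => key (Finset.singleton_nonempty _) (hvb i) (hvbm i) (hvS i),
    fun j => key (Finset.insert_nonempty _ _) (heb j) (hebm j) (heS j)⟩

end SimplicialDecomposition

/-! ### The dimension bound and the conclusion -/

theorem card_le_dimension_add_one {V : Type*} [Fintype V] (K : AbstractSimplicialComplex V)
    {s : Finset V} (hs : s ∈ K.faces) : s.card ≤ dimension K + 1 := by
  obtain ⟨d, hd⟩ := Nat.exists_eq_add_of_le' (Finset.card_pos.2 (K.isRelLowerSet_faces hs).1)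
  -- Boundedness makes the `sSup` in `dimension` a genuine upper bound instead of the default value
  -- `0`.
  have hb : BddAbove {d | ∃ s ∈ K.faces, s.card = d + 1} :=
    ⟨Fintype.card V, by
      rintro d ⟨t, -, ht⟩
      have := Finset.card_le_univ t
      omega⟩
  have : d ≤ dimension K := le_csSup hb ⟨s, hs, hd⟩
  omega

end FCAGraph
end

theorem proposition4p1 {G : Type u} [Group G] (hG : FCAGraph.geometricDimension G = 2)
    {V : Type v} [Fintype V] (X : AbstractSimplicialComplex V)
    (hX : FCAGraph.IsGComplex G X) (hdim : FCAGraph.dimension X = 2)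
    (hFCA : FCAGraph.SatisfiesFCA X) :
    ∃ 𝒢 : FCAGraph.GraphOfGroups.{u},
      (∀ v, FCAGraph.HasSubexponentialGrowth (𝒢.vGroup v)) ∧
      (∀ e, FCAGraph.HasSubexponentialGrowth (𝒢.eGroup e)) ∧
      ∃ T : Set 𝒢.Edge, 𝒢.IsMaximalTree T ∧ Nonempty (G ≃* 𝒢.FundamentalGroup T) := by
  have := hX.pathConnected
  obtain ⟨x₀⟩ := hX.pathConnected.nonempty
  obtain ⟨e⟩ := hX.fundamentalGroup x₀
  obtain ⟨W, _, P, f, hf, hgrowth⟩ := hFCA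
  -- Any one fiber suffices: `0 ≤ ν < (2 - dim P) / 2` rules out `dim P ≥ 2`.
  have hpos := FCAGraph.subexponentialGrowthRate_nonneg.trans_lt
    (hgrowth (FCAGraph.realizationMap hf x₀) x₀ rfl).2
  rw [hdim, EReal.coe_pos] at hpos
  have hP : FCAGraph.dimension P < 2 := by
    have h : (FCAGraph.dimension P : ℝ) < 2 := by
      push_cast at hpos
      linarith
    exact_mod_cast h
  obtain ⟨n, m, D, hv, he⟩ := FCAGraph.exists_spaceDecomposition hf fun s hs => by
    have := FCAGraph.card_le_dimension_add_one P hs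
    omega
  obtain ⟨𝒢, h𝒢v, h𝒢e, h𝒢⟩ := D.exists_graphOfGroups x₀ e
  refine ⟨𝒢, fun i => ?_, fun j => ?_, h𝒢⟩
  · obtain ⟨k, ⟨φ⟩⟩ := h𝒢v i
    rw [hv k] at φ
    exact (hgrowth _ _ rfl).1.of_mulEquiv φ.symm
  · obtain ⟨k, ⟨φ⟩⟩ := h𝒢e j
    rw [he k] at φ
    exact (hgrowth _ _ rfl).1.of_mulEquiv φ.symm
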